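/- Let $\operatorname{ED}(A,B)$ denote the edit distance of two strings: the least number of insertions, deletions and substitutions of single characters that turn $A$ into $B$. There are a single randomized word-RAM algorithm and an absolute constant $e$ such that for every constant $K$ there are constants $C$ and $c$ with the following property. Let $n\ge 1$ and $k\ge 1$ be integers with $k\le K\sqrt n$, let $\Sigma=\{1,\dots,\sigma\}$ be a finite alphabet, and let the words of the machine have $w\ge c\,(\lfloor\log_2 n\rfloor+\lfloor\log_2\sigma\rfloor+1)$ bits. Given $n$, $k$, $\sigma$ and unit-cost random access to the characters of $A,B\in\Sigma^n$ (and no preprocessing of $A$ or $B$), the algorithm always halts with the answer SMALL or LARGE within $$C\cdot\frac{n}{\sqrt k}\cdot\bigl(\log(n+1)\bigr)^{e}=\tilde O\!\left(\frac{n}{\sqrt k}\right)$$ steps, and for all $A,B\in\Sigma^n$, over its random words: * if $\operatorname{ED}(A,B)\le k$, it answers SMALL with probability at least $1-\frac1n$; * if $\operatorname{ED}(A,B)>40k^2$, it answers LARGE with probability at least $1-\frac1n$. -/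

import Mathlib

/-- Edit (Levenshtein) distance: the least number of insertions, deletions and substitutions of
single characters that turn the first string into the second. -/
def editDist {α : Type*} [DecidableEq α] : List α → List α → ℕ
  | [], ys => ys.length
  | _ :: xs, [] => xs.length + 1
  | x :: xs, y :: ys =>
      min (editDist xs (y :: ys) + 1)
        (min (editDist (x :: xs) ys + 1) (editDist xs ys + if x = y then 0 else 1))
termination_by xs ys => xs.length + ys.length

/-- Edit distance of two strings of length `n`. -/
def ED {n σ : ℕ} (A B : Fin n → Fin σ) : ℕ := editDist (List.ofFn A) (List.ofFn B)

/-! ### A randomized word RAM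

Programs of a small imperative language over words of `w` bits, that is, natural numbers below
`2 ^ w`. A program mentions finitely many registers and finitely many arrays; an array is
addressed by a word and holds words. The two input strings can be read at any position at unit
cost, and one instruction draws a uniformly random word. -/

namespace WordRAM

/-- Binary operations of the machine on words. -/
inductive Op
  | add | sub | mul | div | mod | lt | eq

/-- Value of an operation before it is reduced to a word: `sub` is truncated at `0`, `div` and
`mod` are quotient and remainder, `lt` and `eq` return `1` for true and `0` for false. -/
def Op.apply : Op → ℕ → ℕ → ℕ
  | .add, a, b => a + b
  | .sub, a, b => a - b
  | .mul, a, b => a * b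
  | .div, a, b => a / b
  | .mod, a, b => a % b
  | .lt, a, b => if a < b then 1 else 0
  | .eq, a, b => if a = b then 1 else 0

/-- Expressions. `load a e` is the entry of array `a` at address `e`; `charA e` and `charB e` read
position `e` of the first and of the second input string. -/
inductive Expr
  | lit (c : ℕ)
  | reg (x : ℕ)
  | bin (o : Op) (e₁ e₂ : Expr)
  | load (a : ℕ) (e : Expr)
  | charA (e : Expr)
  | charB (e : Expr)

/-- Cost of evaluating an expression: one unit per literal, register, operation and access. -/
def Expr.cost : Expr → ℕ
  | .lit _ => 1
  | .reg _ => 1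
  | .bin _ e₁ e₂ => e₁.cost + e₂.cost + 1
  | .load _ e => e.cost + 1
  | .charA e => e.cost + 1
  | .charB e => e.cost + 1

/-- Programs. -/
inductive Prog
  | skip
  | assign (x : ℕ) (e : Expr)
  | store (a : ℕ) (i e : Expr)
  | rand (x : ℕ)
  | seq (P Q : Prog)
  | ite (e : Expr) (P Q : Prog)
  | while (e : Expr) (P : Prog)

/-- What a run is given and cannot change: the word length, the two input strings (as functions of
the position) and the tape of random words. -/
structure Env where
  w : ℕ
  strA : ℕ → ℕ
  strB : ℕ → ℕ
  tape : ℕ → ℕ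

/-- Registers, arrays, and the number of random words used so far. -/
structure State where
  reg : ℕ → ℕ
  arr : ℕ → ℕ → ℕ
  pos : ℕ

/-- Value of an expression; every result is reduced modulo `2 ^ w`. -/
def Expr.eval (E : Env) (s : State) : Expr → ℕ
  | .lit c => c % 2 ^ E.w
  | .reg x => s.reg x
  | .bin o e₁ e₂ => o.apply (e₁.eval E s) (e₂.eval E s) % 2 ^ E.w
  | .load a e => s.arr a (e.eval E s)
  | .charA e => E.strA (e.eval E s) % 2 ^ E.w
  | .charB e => E.strB (e.eval E s) % 2 ^ E.w

/-- State after writing `v` to register `x`. -/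
def State.setReg (s : State) (x v : ℕ) : State :=
  { s with reg := Function.update s.reg x v }

/-- State after writing `v` to address `i` of array `a`. -/
def State.setArr (s : State) (a i v : ℕ) : State :=
  { s with arr := Function.update s.arr a (Function.update (s.arr a) i v) }

/-- `Exec E P s t s'`: started in state `s`, the program `P` halts in state `s'` after exactly `t`
steps. -/
inductive Exec (E : Env) : Prog → State → ℕ → State → Prop
  | skip (s : State) : Exec E .skip s 1 s
  | assign (s : State) (x : ℕ) (e : Expr) :
      Exec E (.assign x e) s (e.cost + 1) (s.setReg x (e.eval E s))
  | store (s : State) (a : ℕ) (i e : Expr) :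
      Exec E (.store a i e) s (i.cost + e.cost + 1) (s.setArr a (i.eval E s) (e.eval E s))
  | rand (s : State) (x : ℕ) :
      Exec E (.rand x) s 1 { s.setReg x (E.tape s.pos) with pos := s.pos + 1 }
  | seq {P Q : Prog} {s s₁ s₂ : State} {t₁ t₂ : ℕ} :
      Exec E P s t₁ s₁ → Exec E Q s₁ t₂ s₂ → Exec E (.seq P Q) s (t₁ + t₂) s₂
  | iteTrue {e : Expr} {P Q : Prog} {s s₁ : State} {t : ℕ} :
      e.eval E s ≠ 0 → Exec E P s t s₁ → Exec E (.ite e P Q) s (e.cost + 1 + t) s₁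
  | iteFalse {e : Expr} {P Q : Prog} {s s₁ : State} {t : ℕ} :
      e.eval E s = 0 → Exec E Q s t s₁ → Exec E (.ite e P Q) s (e.cost + 1 + t) s₁
  | whileTrue {e : Expr} {P : Prog} {s s₁ s₂ : State} {t₁ t₂ : ℕ} :
      e.eval E s ≠ 0 → Exec E P s t₁ s₁ → Exec E (.while e P) s₁ t₂ s₂ →
      Exec E (.while e P) s (e.cost + 1 + t₁ + t₂) s₂
  | whileFalse {e : Expr} {P : Prog} {s : State} :
      e.eval E s = 0 → Exec E (.while e P) s (e.cost + 1) s

/-- A string as the machine sees it: positions are `0, …, n - 1`, the characters are coded as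
`1, …, σ`, and every position out of range holds the extra symbol `0`. -/
def readString {n σ : ℕ} (A : Fin n → Fin σ) (i : ℕ) : ℕ :=
  if h : i < n then (A ⟨i, h⟩ : ℕ) + 1 else 0

/-- The environment for inputs `A`, `B`, word length `w` and random words `ω`; a run of at most `T`
steps reads at most the first `T` words of the tape. -/
def env {n σ T : ℕ} (w : ℕ) (A B : Fin n → Fin σ) (ω : Fin T → Fin (2 ^ w)) : Env where
  w := w
  strA := readString A
  strB := readString B
  tape i := if h : i < T then (ω ⟨i, h⟩ : ℕ) else 0

/-- The initial state: `n`, `k` and `σ` in registers `0`, `1`, `2`; all else is zero. -/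
def init (w n k σ : ℕ) : State where
  reg x := if x = 0 then n % 2 ^ w else if x = 1 then k % 2 ^ w
    else if x = 2 then σ % 2 ^ w else 0
  arr _ _ := 0
  pos := 0

/-- With random words `ω`, the program halts within `T` steps with the answer `r` in
register `0`. -/
def Answers {n σ T : ℕ} (P : Prog) (w k : ℕ) (A B : Fin n → Fin σ) (r : ℕ)
    (ω : Fin T → Fin (2 ^ w)) : Prop :=
  ∃ t ≤ T, ∃ s : State, Exec (env w A B ω) P (init w n k σ) t s ∧ s.reg 0 = r

/-- Probability, over `T` independent uniformly random words, that the program answers `r` within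
`T` steps. -/
noncomputable def answerProb {n σ : ℕ} (P : Prog) (w k T : ℕ) (A B : Fin n → Fin σ) (r : ℕ) : ℝ :=
  (Nat.card {ω : Fin T → Fin (2 ^ w) // Answers P w k A B r ω} : ℝ) /
    Nat.card (Fin T → Fin (2 ^ w))

/-- The answer `the distance is large`. -/
def LARGE : ℕ := 0

/-- The answer `the distance is small`. -/
def SMALL : ℕ := 1

end WordRAM

/-! ### Edit distance of suffixes -/

section EditDistance

variable {α : Type*} [DecidableEq α]

/-! If `n ≤ 40 k ^ 2`, the distance cannot exceed `40 k ^ 2`, so the program answers SMALL at once.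
All the content is in the case `40 k ^ 2 < n`.

There the program scans `A` in greedy rounds. From a position `i` it seeks a length `l` such that
some diagonal near the main one agrees with `A` at a few sampled positions of the window of length
`l`, while no diagonal passes for `l + 1`; it then jumps to `i + l + 1 + r`. It makes at most `k +
1` rounds and answers SMALL exactly if the scan leaves the string.

If the distance is at most `k`, this is right for every tape. An exact match passes whatever the
samples are (`pass_of_match`), so a failed test shows that an optimal alignment spends an edit on
the stretch just crossed; hence at most `k` rounds stay inside the string (`card_rounds_le`).

For the other side, outside an event of probability at most `1 / n` the samples expose every
diagonal with more than `k` mismatches in its window (`Good`, `card_not_good_le`). A round then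
costs at most `3k + 3r + 2` edits along the main diagonal (`sufDist_le_of_round`), so a scan that
leaves the string shows that the distance is at most `22 k ^ 2` (`ED_le_of_rounds`).

Testing the diagonals one by one would be too slow. With `r = ⌊√k⌋ + 1` each of them is `a * r - b`
with `b < r`, so baby steps and giant steps apply: `r` sample strings of `A` go into a trie and
`O(r)` sample strings of `B` are looked up (`wp_testProg`). A window of length `l` costs about `√k
(l / k + 1)` up to logarithms. The search tests only windows of length at most twice the final `l`
plus one (`wp_updateProg`), so the lengths sum to `O(n)` over `k + 1` rounds, and the total is `√k
(n / k + k) = O(n / √k)` up to logarithms (`wp_greedyProg`, `timeBound_le`). -/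

theorem editDist_nil_left (ys : List α) : editDist [] ys = ys.length := by
  simp [editDist]

theorem editDist_nil_right (xs : List α) : editDist xs [] = xs.length := by
  cases xs <;> simp [editDist]

theorem editDist_cons_cons (x y : α) (xs ys : List α) :
    editDist (x :: xs) (y :: ys) =
      min (editDist xs (y :: ys) + 1)
        (min (editDist (x :: xs) ys + 1) (editDist xs ys + if x = y then 0 else 1)) := by
  rw [editDist]

theorem editDist_cons_left_le (x : α) (xs ys : List α) :
    editDist (x :: xs) ys ≤ editDist xs ys + 1 := by
  cases ys with
  | nil => simp [editDist_nil_right]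
  | cons y ys => rw [editDist_cons_cons]; exact min_le_left _ _

theorem editDist_cons_right_le (y : α) (xs ys : List α) :
    editDist xs (y :: ys) ≤ editDist xs ys + 1 := by
  cases xs with
  | nil => simp [editDist_nil_left]
  | cons x xs =>
    rw [editDist_cons_cons]; exact (min_le_right _ _).trans (min_le_left _ _)

theorem editDist_le_cons_right (y : α) (xs ys : List α) :
    editDist xs ys ≤ editDist xs (y :: ys) + 1 := by
  induction xs with
  | nil => simp [editDist_nil_left]; omega
  | cons x xs ih =>
    rw [editDist_cons_cons]
    have h := editDist_cons_left_le x xs ys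
    omega

/-- An optimal alignment can be cut after any prefix of the first string. -/
theorem editDist_split (xs ys : List α) (t : ℕ) (ht : t ≤ xs.length) :
    ∃ s q₁ q₂ : ℕ, s ≤ ys.length ∧ q₁ + q₂ ≤ editDist xs ys ∧
      editDist (xs.drop t) (ys.drop s) ≤ q₂ ∧ s ≤ t + q₁ ∧ t ≤ s + q₁ ∧
      (q₁ = 0 → xs.take t = ys.take s) := by
  induction xs, ys using editDist.induct generalizing t with
  | case1 ys =>
    obtain rfl : t = 0 := by simpa using ht
    exact ⟨0, 0, editDist [] ys, by simp⟩
  | case2 x xs =>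
    refine ⟨0, t, xs.length + 1 - t, by simp, ?_, ?_, by omega, by omega, ?_⟩
    · simp [editDist_nil_right] at ht ⊢; omega
    · simp [editDist_nil_right]
    · rintro rfl; simp
  | case3 x xs y ys ih₁ ih₂ ih₃ =>
    rcases Nat.eq_zero_or_pos t with rfl | hpos
    · exact ⟨0, 0, editDist (x :: xs) (y :: ys), by simp⟩
    obtain ⟨t, rfl⟩ : ∃ t', t = t' + 1 := ⟨t - 1, by omega⟩
    simp only [List.length_cons] at ht
    rw [editDist_cons_cons]
    rcases min_choice (editDist xs (y :: ys) + 1)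
        (min (editDist (x :: xs) ys + 1) (editDist xs ys + if x = y then 0 else 1)) with h | h
    · rw [h]
      obtain ⟨s, q₁, q₂, h1, h2, h3, h4, h5, -⟩ := ih₁ t (by omega)
      -- The optimal alignment deletes `x`; the first piece now has positive cost, so the clause
      -- about equal prefixes is vacuous. The same holds for an insertion.
      exact ⟨s, q₁ + 1, q₂, h1, by omega, by simpa using h3, by omega, by omega, by omega⟩
    rw [h]
    rcases min_choice (editDist (x :: xs) ys + 1) (editDist xs ys + if x = y then 0 else 1)
      with h' | h'
    · rw [h']
      obtain ⟨s, q₁, q₂, h1, h2, h3, h4, h5, -⟩ := ih₂ (t + 1) (by simpa using ht)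
      exact ⟨s + 1, q₁ + 1, q₂, by simpa using h1, by omega, by simpa using h3, by omega,
        by omega, by omega⟩
    · rw [h']
      obtain ⟨s, q₁, q₂, h1, h2, h3, h4, h5, h6⟩ := ih₃ t (by omega)
      refine ⟨s + 1, q₁ + (if x = y then 0 else 1), q₂, by simpa using h1, by omega,
        by simpa using h3, by omega, by omega, ?_⟩
      intro h0
      have hxy : x = y := by
        by_contra hne
        simp [hne] at h0
      simp only [hxy, if_true, add_zero] at h0
      simp [h6 h0, hxy]

end EditDistance

/-! ### Suffix distances in coordinates where `B` is shifted by `k` -/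

namespace GapED

/-- Shift of a string by `k` positions to the right, with the symbol `0` in front. -/
def shiftBy (k : ℕ) (f : ℕ → ℕ) (z : ℕ) : ℕ := if k ≤ z then f (z - k) else 0

section Suffix

variable {n σ : ℕ} (A B : Fin n → Fin σ)

/-- Edit distance of the suffix of `A` that starts at `i` and the suffix of `B` that starts at
`z - k`. -/
def sufDist (k i z : ℕ) : ℕ := editDist ((List.ofFn A).drop i) ((List.ofFn B).drop (z - k))

open WordRAM (readString)

theorem drop_ofFn_eq_cons {i : ℕ} (h : i < n) :
    (List.ofFn A).drop i = A ⟨i, h⟩ :: (List.ofFn A).drop (i + 1) := by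
  rw [List.drop_eq_getElem_cons (by simpa using h)]
  simp

theorem drop_ofFn_eq_nil {i : ℕ} (h : n ≤ i) : (List.ofFn A).drop i = [] := by
  simpa using h

theorem readString_of_lt {i : ℕ} (h : i < n) : readString A i = (A ⟨i, h⟩ : ℕ) + 1 := by
  simp [readString, h]

theorem readString_of_le {i : ℕ} (h : n ≤ i) : readString A i = 0 := by
  simp [readString, h]

theorem readString_le (i : ℕ) : readString A i ≤ σ := by
  unfold readString
  split
  · omega
  · omega

theorem sufDist_le_succ (k i z : ℕ) : sufDist A B k i z ≤ sufDist A B k (i + 1) z + 1 := by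
  unfold sufDist
  rcases lt_or_ge i n with h | h
  · rw [drop_ofFn_eq_cons A h]; exact editDist_cons_left_le _ _ _
  · rw [drop_ofFn_eq_nil A h, drop_ofFn_eq_nil A (by omega)]; omega

theorem sufDist_succ_right_le (k i z : ℕ) :
    sufDist A B k i (z + 1) ≤ sufDist A B k i z + 1 := by
  unfold sufDist
  rcases lt_or_ge z k with hz | hz
  · rw [show z + 1 - k = z - k by omega]; omega
  rw [show z + 1 - k = z - k + 1 by omega]
  rcases lt_or_ge (z - k) n with h | h
  · rw [drop_ofFn_eq_cons B h]; exact editDist_le_cons_right _ _ _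
  · rw [drop_ofFn_eq_nil B h, drop_ofFn_eq_nil B (by omega)]; omega

theorem sufDist_le_succ_right (k i z : ℕ) :
    sufDist A B k i z ≤ sufDist A B k i (z + 1) + 1 := by
  unfold sufDist
  rcases lt_or_ge z k with hz | hz
  · rw [show z + 1 - k = z - k by omega]; omega
  rw [show z + 1 - k = z - k + 1 by omega]
  rcases lt_or_ge (z - k) n with h | h
  · rw [drop_ofFn_eq_cons B h]; exact editDist_cons_right_le _ _ _
  · rw [drop_ofFn_eq_nil B h, drop_ofFn_eq_nil B (by omega)]; omega

/-- The sentinel `0` is harmless everywhere. In front of `B` or past one end it differs from every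
real character, and the unit paid covers a deletion or an insertion. Where `A` is exhausted and the
other side also reads `0`, no edit is needed, because the two pairs of suffixes coincide. -/
theorem sufDist_diag_le (k i z : ℕ) :
    sufDist A B k i z ≤ sufDist A B k (i + 1) (z + 1) +
      if readString A i = shiftBy k (readString B) z then 0 else 1 := by
  rcases lt_or_ge z k with hz | hz
  · rw [shiftBy, if_neg (not_le.2 hz)]
    have h0 : sufDist A B k (i + 1) (z + 1) = sufDist A B k (i + 1) z := by
      unfold sufDist; rw [show z + 1 - k = z - k by omega]
    rw [h0]
    rcases lt_or_ge i n with h | h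
    · rw [readString_of_lt A h]; simpa using sufDist_le_succ A B k i z
    · rw [readString_of_le A h]
      unfold sufDist
      rw [drop_ofFn_eq_nil A h, drop_ofFn_eq_nil A (by omega)]; simp
  rw [shiftBy, if_pos hz]
  unfold sufDist
  rw [show z + 1 - k = z - k + 1 by omega]
  rcases lt_or_ge i n with h | h <;> rcases lt_or_ge (z - k) n with h' | h'
  · rw [drop_ofFn_eq_cons A h, drop_ofFn_eq_cons B h', readString_of_lt A h,
      readString_of_lt B h', editDist_cons_cons]
    have : (((A ⟨i, h⟩ : Fin σ) : ℕ) + 1 = (B ⟨z - k, h'⟩ : ℕ) + 1) ↔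
        A ⟨i, h⟩ = B ⟨z - k, h'⟩ := by
      rw [Fin.ext_iff]; omega
    simp only [this]
    exact (min_le_right _ _).trans (min_le_right _ _)
  · rw [readString_of_lt A h, readString_of_le B h', drop_ofFn_eq_nil B h',
      drop_ofFn_eq_nil B (by omega : n ≤ z - k + 1), drop_ofFn_eq_cons A h]
    simpa using editDist_cons_left_le _ _ _
  · rw [readString_of_le A h, readString_of_lt B h', drop_ofFn_eq_nil A h,
      drop_ofFn_eq_nil A (by omega : n ≤ i + 1), drop_ofFn_eq_cons B h']
    simpa using editDist_cons_right_le _ _ _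
  · rw [drop_ofFn_eq_nil A h, drop_ofFn_eq_nil A (by omega : n ≤ i + 1), drop_ofFn_eq_nil B h',
      drop_ofFn_eq_nil B (by omega : n ≤ z - k + 1)]
    simp

theorem sufDist_le_add_left (k i z d : ℕ) : sufDist A B k i z ≤ sufDist A B k (i + d) z + d := by
  induction d with
  | zero => simp
  | succ d ih => have := sufDist_le_succ A B k (i + d) z; rw [← add_assoc i]; omega

theorem sufDist_le_add_right (k i z d : ℕ) : sufDist A B k i z ≤ sufDist A B k i (z + d) + d := by
  induction d with
  | zero => simp
  | succ d ih => have := sufDist_le_succ_right A B k i (z + d); rw [← add_assoc z]; omega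

theorem sufDist_add_right_le (k i z d : ℕ) : sufDist A B k i (z + d) ≤ sufDist A B k i z + d := by
  induction d with
  | zero => simp
  | succ d ih => have := sufDist_succ_right_le A B k i (z + d); rw [← add_assoc z]; omega

theorem sufDist_lipschitz_right (k i z y d : ℕ) (h : z ≤ y + d) (h' : y ≤ z + d) :
    sufDist A B k i z ≤ sufDist A B k i y + d := by
  rcases le_total z y with hz | hz
  · obtain ⟨e, rfl⟩ := Nat.exists_eq_add_of_le hz
    have := sufDist_le_add_right A B k i z e; omega
  · obtain ⟨e, rfl⟩ := Nat.exists_eq_add_of_le hz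
    have := sufDist_add_right_le A B k i y e; omega

/-- Positions `x < l` at which `A` from `p` on differs from the shifted `B` from `z` on. -/
def mismatches (k p z l : ℕ) : Finset ℕ :=
  {x ∈ Finset.range l | readString A (p + x) ≠ shiftBy k (readString B) (z + x)}

/-- Following one diagonal pays only at mismatches, and their number is what sampling controls. -/
theorem sufDist_le_add_mismatches (k p z l : ℕ) :
    sufDist A B k p z ≤ sufDist A B k (p + l) (z + l) + (mismatches A B k p z l).card := by
  induction l with
  | zero => simp
  | succ l ih =>
    have h := sufDist_diag_le A B k (p + l) (z + l)
    have hc : (mismatches A B k p z (l + 1)).card = (mismatches A B k p z l).card +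
        if readString A (p + l) = shiftBy k (readString B) (z + l) then 0 else 1 := by
      unfold mismatches
      rw [Finset.range_add_one, Finset.filter_insert]
      by_cases hh : readString A (p + l) = shiftBy k (readString B) (z + l)
      · simp [hh]
      · simp [hh]
    rw [hc, ← add_assoc p, ← add_assoc z]
    omega

end Suffix

/-! ### Greedy rounds -/

/-- Number of samples for a window of length `l`. -/
def numSamples (k L l : ℕ) : ℕ := (l / k + 1) * L

/-- Some diagonal agrees with the window of length `l` of `f` at `i` on all samples. -/
def PassStr (f g : ℕ → ℕ) (k r L : ℕ) (R : ℕ → ℕ) (i l : ℕ) : Prop :=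
  ∃ b < r, ∃ a, a * r < 2 * k + r ∧ ∀ j < numSamples k L l,
    f (i + R j % l + b) = shiftBy k g (i + R j % l + a * r)

section Rounds

variable {n σ : ℕ} (A B : Fin n → Fin σ) (k r L : ℕ) (R : ℕ → ℕ)

open WordRAM (readString)

/-- `PassStr` for the input strings. -/
def Pass (i l : ℕ) : Prop := PassStr (readString A) (readString B) k r L R i l

/-- One greedy round, which starts at the first position and ends at the second. -/
def Round (i i' : ℕ) : Prop :=
  ∃ l, i' = i + l + 1 + r ∧ (l = 0 ∨ i + l + r ≤ n ∧ Pass A B k r L R i l) ∧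
    (i' ≤ n → ¬ Pass A B k r L R i (l + 1))

/-- `g` greedy rounds lead from `0` to `i`, where only the last may leave the string. -/
inductive Rounds : ℕ → ℕ → Prop
  | zero : Rounds 0 0
  | succ {g i i' : ℕ} : Rounds g i → i ≤ n → Round A B k r L R i i' → Rounds (g + 1) i'

variable {A B k r L R}

/-- Take `a = ⌈D / r⌉` and `b = a * r - D < r`. A sample `x < l` read at offset `b` looks at
position `i + x + b < i + l + r`; this is why the match must extend over `l + r` positions, and why
a round later jumps `r` further. -/
theorem pass_of_match {i l D : ℕ} (hr : 0 < r) (hD : D ≤ 2 * k) (hl : 0 < l)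
    (h : ∀ p, i ≤ p → p < i + l + r →
      readString A p = shiftBy k (readString B) (p + D)) : Pass A B k r L R i l := by
  have hdm := Nat.div_add_mod (D + r - 1) r
  have hlt := Nat.mod_lt (D + r - 1) hr
  set a := (D + r - 1) / r
  have hmul : a * r = r * a := mul_comm _ _
  refine ⟨a * r - D, by omega, a, by omega, fun j _ => ?_⟩
  have hj := Nat.mod_lt (R j) hl
  rw [h _ (by omega) (by omega)]
  congr 1
  omega

/-- An optimal alignment is followed along the rounds. `j` is the position in `B` that it pairs with
`i`, and `e` is the budget left for the suffixes. Each round lowers the budget by at least one, and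
the drift between `i` and `j` stays within `k - e`, so the current diagonal is always among those
tested. -/
theorem card_rounds_le (hr : 0 < r) {q g i : ℕ} (hED : ED A B ≤ q) (hq : q ≤ k)
    (h : Rounds A B k r L R g i) (hi : i ≤ n) : g ≤ q := by
  suffices H : ∃ j e, editDist ((List.ofFn A).drop i) ((List.ofFn B).drop j) ≤ e ∧
      i ≤ j + (k - e) ∧ j ≤ i + (k - e) ∧ e + g ≤ q by
    obtain ⟨j, e, -, -, -, h⟩ := H; omega
  induction h with
  | zero => exact ⟨0, q, by simpa [ED] using hED, by omega, by omega, by omega⟩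
  | @succ g i i' h _ hrd ih =>
    obtain ⟨l, rfl, -, hnp⟩ := hrd
    obtain ⟨j, e, h1, h2, h3, h4⟩ := ih (by omega)
    obtain ⟨s, q₁, q₂, hs, hq12, hd, hs1, hs2, htk⟩ :=
      editDist_split ((List.ofFn A).drop i) ((List.ofFn B).drop j) (l + 1 + r)
        (by simp; omega)
    rw [List.drop_drop, List.drop_drop] at hd
    -- If the alignment crossed this stretch for free, `A` would match `B` exactly on the diagonal
    -- `j + k - i`, and the test for `l + 1` would have passed.
    have hq1 : q₁ ≠ 0 := by
      intro h0
      have heq := htk h0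
      refine hnp hi (pass_of_match (D := j + k - i) hr (by omega) (by omega) ?_)
      intro p hp hp'
      have hst : s = l + 1 + r := by omega
      subst hst
      have hlen : l + 1 + r ≤ n - j := by simpa using hs
      have hpj : p + (j + k - i) - k < n := by omega
      rw [shiftBy, if_pos (by omega), readString_of_lt A (by omega : p < n),
        readString_of_lt B hpj]
      have := congrArg (fun l => l[p - i]?) heq
      simp only [List.getElem?_take, List.getElem?_drop] at this
      rw [if_pos (by omega), if_pos (by omega), List.getElem?_ofFn, List.getElem?_ofFn,
        dif_pos (by omega), dif_pos (by omega), Option.some_inj] at this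
      have e1 : i + (p - i) = p := by omega
      have e2 : j + (p - i) = p + (j + k - i) - k := by omega
      simp only [e1, e2] at this
      rw [this]
    refine ⟨j + s, q₂, by rw [show i + l + 1 + r = i + (l + 1 + r) by omega]; exact hd,
      by omega, by omega, by omega⟩

/-- The samples find every diagonal with more than `k` mismatches. -/
def Good (A B : Fin n → Fin σ) (k r L : ℕ) (R : ℕ → ℕ) : Prop :=
  ∀ i ≤ n, ∀ l, 0 < l → l ≤ n → ∀ b < r, ∀ z < 2 * k + r,
    k < (mismatches A B k (i + b) (i + z) l).card →
    ∃ j < numSamples k L l, R j % l ∈ mismatches A B k (i + b) (i + z) l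

/-- A detour over the passing diagonal: drop `b` characters of `A`, shift sideways by at most `k +
r`, follow the diagonal with at most `k` mismatches, drop the remaining `1 + r - b` characters of
`A`, and shift back by at most `k + r + 1`. With `l = 0` no test has passed and `1 + r` characters
are dropped on both sides. -/
theorem sufDist_le_of_round (hG : Good A B k r L R) {i i' : ℕ} (hi : i ≤ n)
    (h : Round A B k r L R i i') :
    sufDist A B k i (i + k) ≤ sufDist A B k i' (i' + k) + (3 * k + 3 * r + 2) := by
  obtain ⟨l, rfl, hp, -⟩ := h
  rcases Nat.eq_zero_or_pos l with rfl | hl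
  · have h1 := sufDist_le_add_left A B k i (i + k) (1 + r)
    have h2 := sufDist_le_add_right A B k (i + (1 + r)) (i + k) (1 + r)
    rw [show i + 0 + 1 + r = i + (1 + r) by omega,
      show i + (1 + r) + k = i + k + (1 + r) by omega]
    omega
  obtain ⟨hln, b, hb, a, ha, hm⟩ := hp.resolve_left hl.ne'
  have hc : (mismatches A B k (i + b) (i + a * r) l).card ≤ k := by
    by_contra hgt
    obtain ⟨j, hj, hmem⟩ := hG i hi l hl (by omega) b hb _ ha (by omega)
    simp only [mismatches, Finset.mem_filter] at hmem
    apply hmem.2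
    have := hm j hj
    rw [show i + b + R j % l = i + R j % l + b by omega,
      show i + a * r + R j % l = i + R j % l + a * r by omega]
    exact this
  have h1 := sufDist_le_add_left A B k i (i + k) b
  have h2 := sufDist_lipschitz_right A B k (i + b) (i + k) (i + a * r) (k + r)
    (by omega) (by omega)
  have h3 := sufDist_le_add_mismatches A B k (i + b) (i + a * r) l
  have h4 := sufDist_le_add_left A B k (i + b + l) (i + a * r + l) (1 + r - b)
  have h5 := sufDist_lipschitz_right A B k (i + b + l + (1 + r - b)) (i + a * r + l)
    (i + l + 1 + r + k) (k + r + 1) (by omega) (by omega)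
  rw [show i + b + l + (1 + r - b) = i + l + 1 + r by omega] at h4 h5
  omega

/-- The bounds for single rounds telescope along the main diagonal, down to a position beyond both
ends where the two suffixes are empty. -/
theorem ED_le_of_rounds (hG : Good A B k r L R) {g i : ℕ}
    (h : Rounds A B k r L R g i) (hi : n < i) : ED A B ≤ g * (3 * k + 3 * r + 2) := by
  have hz : sufDist A B k i (i + k) = 0 := by
    unfold sufDist
    rw [drop_ofFn_eq_nil A hi.le, drop_ofFn_eq_nil B (by omega), editDist_nil_left]
    rfl
  have hED : ED A B = sufDist A B k 0 (0 + k) := by simp [ED, sufDist]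
  have key : sufDist A B k 0 (0 + k) ≤ sufDist A B k i (i + k) + g * (3 * k + 3 * r + 2) := by
    clear hz hi
    induction h with
    | zero => simp
    | @succ g i i' h hle hrd ih =>
      have h2 := sufDist_le_of_round hG hle hrd
      rw [Nat.add_mul]; omega
  omega

end Rounds

end GapED

namespace GapED

open WordRAM

/-! ### Weakest preconditions with time -/

/-- `P` halts from `s`, and its time and final state satisfy `Q`. -/
def Wp (E : Env) (P : Prog) (s : State) (Q : ℕ → State → Prop) : Prop :=
  ∃ t s', Exec E P s t s' ∧ Q t s'

section Rules

variable {E : Env} {P P' : Prog} {s s' : State} {Q : ℕ → State → Prop} {e i : Expr} {x a : ℕ}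

theorem Wp.mono {Q' : ℕ → State → Prop} (h : Wp E P s Q) (hQ : ∀ t s, Q t s → Q' t s) :
    Wp E P s Q' := by
  obtain ⟨t, s', h, hq⟩ := h
  exact ⟨t, s', h, hQ _ _ hq⟩

theorem Wp.skip (h : Q 1 s) : Wp E .skip s Q := ⟨_, _, .skip s, h⟩

theorem Wp.assign (he : e.eval E s = a) (hs : s.setReg x a = s') (h : Q (e.cost + 1) s') :
    Wp E (.assign x e) s Q := ⟨_, _, .assign s x e, by rwa [he, hs]⟩

theorem Wp.store {arr idx : ℕ} (hi : i.eval E s = idx) (he : e.eval E s = a)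
    (hs : s.setArr arr idx a = s') (h : Q (i.cost + e.cost + 1) s') :
    Wp E (.store arr i e) s Q := ⟨_, _, .store s arr i e, by rwa [hi, he, hs]⟩

theorem Wp.seq (h : Wp E P s fun t₁ s₁ => Wp E P' s₁ fun t₂ s₂ => Q (t₁ + t₂) s₂) :
    Wp E (.seq P P') s Q := by
  obtain ⟨t₁, s₁, h₁, t₂, s₂, h₂, hq⟩ := h
  exact ⟨_, _, .seq h₁ h₂, hq⟩

theorem Wp.seq_assign (he : e.eval E s = a) (hs : s.setReg x a = s')
    (h : Wp E P s' fun t₂ s₂ => Q (e.cost + 1 + t₂) s₂) :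
    Wp E (.seq (.assign x e) P) s Q := .seq (.assign he hs h)

theorem Wp.ite (h₁ : e.eval E s ≠ 0 → Wp E P s fun t s' => Q (e.cost + 1 + t) s')
    (h₂ : e.eval E s = 0 → Wp E P' s fun t s' => Q (e.cost + 1 + t) s') :
    Wp E (.ite e P P') s Q := by
  by_cases h : e.eval E s = 0
  · obtain ⟨t, s', hP, hq⟩ := h₂ h
    exact ⟨_, _, .iteFalse h hP, hq⟩
  · obtain ⟨t, s', hP, hq⟩ := h₁ h
    exact ⟨_, _, .iteTrue h hP, hq⟩

/-- The rule for loops, with an invariant `I φ s` that bounds the remaining time by the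
potential `φ`. -/
theorem Wp.while (I : ℕ → State → Prop) {φ : ℕ} (h0 : I φ s)
    (hstep : ∀ φ s, I φ s → e.eval E s ≠ 0 →
      Wp E P s fun t s' => ∃ φ', I φ' s' ∧ e.cost + 1 + t + φ' ≤ φ)
    (hend : ∀ φ' s' t, I φ' s' → e.eval E s' = 0 → t ≤ φ + e.cost + 1 → Q t s') :
    Wp E (.while e P) s Q := by
  induction φ using Nat.strong_induction_on generalizing s Q with
  | _ φ ih =>
    by_cases h : e.eval E s = 0
    · exact ⟨_, _, .whileFalse h, hend φ s _ h0 h (by omega)⟩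
    · obtain ⟨t, s', hex, φ', hI, hle⟩ := hstep φ s h0 h
      obtain ⟨t₂, s₂, hex₂, hq⟩ := ih φ' (by omega) hI
        (Q := fun t₂ s₂ => Q (e.cost + 1 + t + t₂) s₂)
        (fun ψ s₂ t₂ hI₂ h₂ ht => hend ψ s₂ _ hI₂ h₂ (by omega))
      exact ⟨_, _, .whileTrue h hex hex₂, hq⟩

end Rules

/-! ### Named registers -/

/-- Contents of the registers of the program. -/
structure Vars where
  n : ℕ := 0
  k : ℕ := 0
  s : ℕ := 0
  r : ℕ := 0
  L : ℕ := 0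
  p : ℕ := 0
  M : ℕ := 0
  j : ℕ := 0
  x : ℕ := 0
  ctr : ℕ := 0
  i : ℕ := 0
  g : ℕ := 0
  lo : ℕ := 0
  hi : ℕ := 0
  mid : ℕ := 0
  ok : ℕ := 0
  m : ℕ := 0
  root : ℕ := 0
  b : ℕ := 0
  node : ℕ := 0
  y : ℕ := 0
  q : ℕ := 0

/-- The registers in order. -/
def Vars.toList (v : Vars) : List ℕ :=
  [v.n, v.k, v.s, v.r, v.L, v.p, v.M, v.j, v.x, v.ctr, v.i, v.g, v.lo, v.hi, v.mid, v.ok, v.m,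
    v.root, v.b, v.node, v.y, v.q]

/-- The state with given registers, trie array `T` and array `R` of random words. -/
def st (v : Vars) (T R : ℕ → ℕ) (pos : ℕ) : State where
  reg x := v.toList.getD x 0
  arr a := if a = 0 then T else if a = 1 then R else fun _ => 0
  pos := pos

section Set

variable (v : Vars) (T R : ℕ → ℕ) (pos a i : ℕ)

/-- Registers are entries of a list with default `0`, so a write becomes `List.set`; on a concrete
record this computes, and the equations below hold by `rfl`. -/
theorem st_setReg {v v' : Vars} {i a : ℕ} (hi : i < v.toList.length)
    (h : v.toList.set i a = v'.toList) : (st v T R pos).setReg i a = st v' T R pos := by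
  refine congrArg (fun f => State.mk f _ _) (funext fun x => ?_)
  rw [← h]
  by_cases hx : x = i
  · subst hx; simp [List.getD_eq_getElem?_getD, hi]
  · simp [List.getD_eq_getElem?_getD, hx, Ne.symm hx, st]

theorem set_n : (st v T R pos).setReg 0 a = st { v with n := a } T R pos :=
  st_setReg T R pos (by simp [Vars.toList]) rfl

theorem set_s : (st v T R pos).setReg 2 a = st { v with s := a } T R pos :=
  st_setReg T R pos (by simp [Vars.toList]) rfl

theorem set_r : (st v T R pos).setReg 3 a = st { v with r := a } T R pos :=
  st_setReg T R pos (by simp [Vars.toList]) rfl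

theorem set_L : (st v T R pos).setReg 4 a = st { v with L := a } T R pos :=
  st_setReg T R pos (by simp [Vars.toList]) rfl

theorem set_p : (st v T R pos).setReg 5 a = st { v with p := a } T R pos :=
  st_setReg T R pos (by simp [Vars.toList]) rfl

theorem set_M : (st v T R pos).setReg 6 a = st { v with M := a } T R pos :=
  st_setReg T R pos (by simp [Vars.toList]) rfl

theorem set_j : (st v T R pos).setReg 7 a = st { v with j := a } T R pos :=
  st_setReg T R pos (by simp [Vars.toList]) rfl

theorem set_x : (st v T R pos).setReg 8 a = st { v with x := a } T R pos :=
  st_setReg T R pos (by simp [Vars.toList]) rfl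

theorem set_ctr : (st v T R pos).setReg 9 a = st { v with ctr := a } T R pos :=
  st_setReg T R pos (by simp [Vars.toList]) rfl

theorem set_i : (st v T R pos).setReg 10 a = st { v with i := a } T R pos :=
  st_setReg T R pos (by simp [Vars.toList]) rfl

theorem set_g : (st v T R pos).setReg 11 a = st { v with g := a } T R pos :=
  st_setReg T R pos (by simp [Vars.toList]) rfl

theorem set_lo : (st v T R pos).setReg 12 a = st { v with lo := a } T R pos :=
  st_setReg T R pos (by simp [Vars.toList]) rfl

theorem set_hi : (st v T R pos).setReg 13 a = st { v with hi := a } T R pos :=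
  st_setReg T R pos (by simp [Vars.toList]) rfl

theorem set_mid : (st v T R pos).setReg 14 a = st { v with mid := a } T R pos :=
  st_setReg T R pos (by simp [Vars.toList]) rfl

theorem set_ok : (st v T R pos).setReg 15 a = st { v with ok := a } T R pos :=
  st_setReg T R pos (by simp [Vars.toList]) rfl

theorem set_m : (st v T R pos).setReg 16 a = st { v with m := a } T R pos :=
  st_setReg T R pos (by simp [Vars.toList]) rfl

theorem set_root : (st v T R pos).setReg 17 a = st { v with root := a } T R pos :=
  st_setReg T R pos (by simp [Vars.toList]) rfl

theorem set_b : (st v T R pos).setReg 18 a = st { v with b := a } T R pos :=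
  st_setReg T R pos (by simp [Vars.toList]) rfl

theorem set_node : (st v T R pos).setReg 19 a = st { v with node := a } T R pos :=
  st_setReg T R pos (by simp [Vars.toList]) rfl

theorem set_y : (st v T R pos).setReg 20 a = st { v with y := a } T R pos :=
  st_setReg T R pos (by simp [Vars.toList]) rfl

theorem set_q : (st v T R pos).setReg 21 a = st { v with q := a } T R pos :=
  st_setReg T R pos (by simp [Vars.toList]) rfl

theorem set_trie : (st v T R pos).setArr 0 i a = st v (Function.update T i a) R pos := by
  refine congrArg (fun f => State.mk _ f _) (funext fun x => ?_)
  by_cases h : x = 0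
  · subst h; exact Function.update_self ..
  · rw [Function.update_of_ne h]
    simp [st, h]

theorem set_rand : (st v T R pos).setArr 1 i a = st v T (Function.update R i a) pos := by
  refine congrArg (fun f => State.mk _ f _) (funext fun x => ?_)
  by_cases h : x = 1
  · subst h; exact Function.update_self ..
  · rw [Function.update_of_ne h]
    simp [st, h]

end Set

end GapED

namespace GapED

open WordRAM

/-! ### Tries in a zero-initialised array -/

/-- The node reached from `u` along `l` in the trie `T` with `s` children per node; `0` stands for
no node. -/
def walk (T : ℕ → ℕ) (s u : ℕ) (l : List ℕ) : ℕ := l.foldl (fun u c => T (u * s + c)) u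

theorem walk_append (T : ℕ → ℕ) (s u : ℕ) (l : List ℕ) (c : ℕ) :
    walk T s u (l ++ [c]) = T (walk T s u l * s + c) := by
  simp [walk]

/-- Nodes above `ctr` are unused and node `0` has no children. -/
structure Blank (T : ℕ → ℕ) (s ctr : ℕ) : Prop where
  dead : ∀ a < s, T a = 0
  fresh : ∀ a, (ctr + 1) * s ≤ a → T a = 0

/-- The nodes `root, …, ctr` of `T` form a trie all of whose words belong to `S`. -/
structure IsTrie (T : ℕ → ℕ) (s root ctr : ℕ) (S : Set (List ℕ)) : Prop extends Blank T s ctr where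
  root_pos : 0 < root
  root_le : root ≤ ctr
  exists_label : ∃ lab : ℕ → List ℕ, lab root = [] ∧
    (∀ u c, root ≤ u → u ≤ ctr → c < s → T (u * s + c) ≠ 0 →
      root < T (u * s + c) ∧ T (u * s + c) ≤ ctr ∧ lab (T (u * s + c)) = lab u ++ [c]) ∧
    ∀ u, root < u → u ≤ ctr → lab u ∈ S

/-- The array is never cleared between tests: the next unused number serves as a new root, since its
cells are still zero. -/
theorem Blank.isTrie {T : ℕ → ℕ} {s ctr : ℕ} (h : Blank T s ctr) (S : Set (List ℕ)) :
    IsTrie T s (ctr + 1) (ctr + 1) S where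
  dead := h.dead
  fresh a ha := h.fresh a (le_trans (Nat.mul_le_mul_right _ (by omega)) ha)
  root_pos := by omega
  root_le := le_rfl
  exists_label := by
    refine ⟨fun _ => [], rfl, fun u c h1 h2 hc hT => ?_, fun u h1 h2 => by omega⟩
    obtain rfl : u = ctr + 1 := by omega
    exact absurd (h.fresh _ (by omega)) hT

/-- The second trie has all the edges of the first. -/
def Extends (T T' : ℕ → ℕ) : Prop := ∀ a, T a ≠ 0 → T' a = T a

/-- Node `0` is absorbing because its cells remain zero: a walk that has fallen off the trie never
returns. -/
theorem walk_ne_zero_of_append {T : ℕ → ℕ} {s u : ℕ} (hd : ∀ a < s, T a = 0) {l : List ℕ} {c : ℕ}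
    (hc : c < s) (h : walk T s u (l ++ [c]) ≠ 0) : walk T s u l ≠ 0 := by
  intro h0
  rw [walk_append, h0, zero_mul, zero_add] at h
  exact h (hd c hc)

theorem Extends.walk_eq {T T' : ℕ → ℕ} {s u : ℕ} (hE : Extends T T') (hd : ∀ a < s, T a = 0)
    {l : List ℕ} (hl : ∀ c ∈ l, c < s) (h : walk T s u l ≠ 0) :
    walk T' s u l = walk T s u l := by
  induction l using List.reverseRecOn with
  | nil => rfl
  | append_singleton l c ih =>
    have h' := walk_ne_zero_of_append hd (hl c (by simp)) h
    rw [walk_append, walk_append, ih (fun c hc => hl c (by simp [hc])) h']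
    rw [walk_append] at h
    exact hE _ h

/-- By induction a surviving walk ends in a node labelled by the word read. This makes lookups
exact: no word outside `S` can be found by accident. -/
theorem IsTrie.walk_spec {T : ℕ → ℕ} {s root ctr : ℕ} {S : Set (List ℕ)}
    (h : IsTrie T s root ctr S) {l : List ℕ} (hl : ∀ c ∈ l, c < s) (hw : walk T s root l ≠ 0) :
    root ≤ walk T s root l ∧ walk T s root l ≤ ctr ∧ (l ≠ [] → l ∈ S) := by
  obtain ⟨lab, h0, he, hS⟩ := h.exists_label
  have key : root ≤ walk T s root l ∧ walk T s root l ≤ ctr ∧ lab (walk T s root l) = l ∧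
      (l ≠ [] → root < walk T s root l) := by
    induction l using List.reverseRecOn with
    | nil => exact ⟨le_rfl, h.root_le, h0, fun h => absurd rfl h⟩
    | append_singleton l c ih =>
      have h' := walk_ne_zero_of_append h.dead (hl c (by simp)) hw
      obtain ⟨h1, h2, h3, -⟩ := ih (fun c hc => hl c (by simp [hc])) h'
      rw [walk_append] at hw ⊢
      obtain ⟨h4, h5, h6⟩ := he _ _ h1 h2 (hl c (by simp)) hw
      exact ⟨h4.le, h5, by rw [h6, h3], fun _ => h4⟩
  refine ⟨key.1, key.2.1, fun hne => ?_⟩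
  rw [← key.2.2.1]
  exact hS _ (key.2.2.2 hne) key.2.1

/-- The new node `ctr + 1` receives the label `l ++ [c]`. The cell written lies above the cells of
node `0` and below those of the unused nodes, so both kinds of zero cells survive. -/
theorem IsTrie.insert {T : ℕ → ℕ} {s root ctr : ℕ} {S : Set (List ℕ)}
    (h : IsTrie T s root ctr S) {l : List ℕ} {c : ℕ} (hl : ∀ c ∈ l, c < s)
    (hw : walk T s root l ≠ 0) (hc : c < s) (hS : l ++ [c] ∈ S) :
    IsTrie (Function.update T (walk T s root l * s + c) (ctr + 1)) s root (ctr + 1) S := by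
  obtain ⟨h1, h2, -⟩ := h.walk_spec hl hw
  obtain ⟨lab, h0, he, hS'⟩ := h.exists_label
  have hlab : lab (walk T s root l) = l := by
    clear h1 h2 hS
    induction l using List.reverseRecOn with
    | nil => exact h0
    | append_singleton l c ih =>
      have hl' : ∀ c ∈ l, c < s := fun c hc => hl c (by simp [hc])
      have h' := walk_ne_zero_of_append h.dead (hl c (by simp)) hw
      obtain ⟨h1, h2, -⟩ := h.walk_spec hl' h'
      rw [walk_append] at hw ⊢
      rw [(he _ _ h1 h2 (hl c (by simp)) hw).2.2, ih hl' h']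
  set u₀ := walk T s root l
  have hrp := h.root_pos
  -- Quotient and remainder by `s` recover the node and the symbol from an address, so exactly one
  -- edge changes.
  have hinj : ∀ u d, d < s → u * s + d = u₀ * s + c → u = u₀ ∧ d = c := by
    intro u d hd heq
    have hs : 0 < s := by omega
    have e1 := congrArg (· / s) heq
    have e2 := congrArg (· % s) heq
    simp only [Nat.mul_add_mod_self_right, Nat.mod_eq_of_lt hd, Nat.mod_eq_of_lt hc] at e2
    rw [mul_comm u, mul_comm u₀] at e1
    simp only [Nat.mul_add_div hs, Nat.div_eq_of_lt hd, Nat.div_eq_of_lt hc] at e1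
    exact ⟨by simpa using e1, e2⟩
  have hu0 : 1 * s ≤ u₀ * s := Nat.mul_le_mul_right _ (by omega)
  have hu1 : u₀ * s ≤ ctr * s := Nat.mul_le_mul_right _ h2
  refine ⟨⟨fun a ha => ?_, fun a ha => ?_⟩, hrp, by have := h.root_le; omega,
    Function.update lab (ctr + 1) (l ++ [c]), ?_, ?_, ?_⟩
  · rw [Function.update_of_ne (by omega)]
    exact h.dead a ha
  · have e : (ctr + 1 + 1) * s = ctr * s + s + s := by ring
    have e' : (ctr + 1) * s = ctr * s + s := by ring
    rw [Function.update_of_ne (by omega)]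
    exact h.fresh a (by omega)
  · rw [Function.update_of_ne (by have := h.root_le; omega)]
    exact h0
  · intro u d hu hu' hd hne
    by_cases heq : u * s + d = u₀ * s + c
    · obtain ⟨rfl, rfl⟩ := hinj u d hd heq
      rw [Function.update_self, Function.update_self, Function.update_of_ne (by omega), hlab]
      exact ⟨by omega, le_rfl, rfl⟩
    · rw [Function.update_of_ne heq] at hne ⊢
      have hu'' : u ≤ ctr := by
        by_contra hgt
        obtain rfl : u = ctr + 1 := by omega
        exact hne (h.fresh _ (by omega))
      obtain ⟨h4, h5, h6⟩ := he u d hu hu'' hd hne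
      rw [Function.update_of_ne (by omega), Function.update_of_ne (by omega)]
      exact ⟨h4, by omega, h6⟩
  · intro u hu hu'
    by_cases hc' : u = ctr + 1
    · rw [hc', Function.update_self]; exact hS
    · rw [Function.update_of_ne hc']; exact hS' u hu (by omega)

/-- The first `j` values of `f`. -/
def pre (f : ℕ → ℕ) (j : ℕ) : List ℕ := (List.range j).map f

theorem pre_succ (f : ℕ → ℕ) (j : ℕ) : pre f (j + 1) = pre f j ++ [f j] := by
  simp [pre, List.range_succ]

theorem mem_pre_lt {f : ℕ → ℕ} {j s : ℕ} (hf : ∀ j, f j < s) : ∀ c ∈ pre f j, c < s := by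
  intro c hc
  simp only [pre, List.mem_map] at hc
  obtain ⟨a, -, rfl⟩ := hc
  exact hf a

theorem pre_eq_pre_iff {f g : ℕ → ℕ} {j : ℕ} : pre f j = pre g j ↔ ∀ x < j, f x = g x := by
  simp [pre]

theorem length_pre (f : ℕ → ℕ) (j : ℕ) : (pre f j).length = j := by simp [pre]

/-! ### The test for a window -/

section Program

open Expr Prog

/-- Insert the samples of `A` at offset `b` into the trie. -/
def insertProg : Prog :=
  seq (assign 19 (reg 17)) <| seq (assign 7 (lit 0)) <|
  .while (bin .lt (reg 7) (reg 16)) <|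
    seq (assign 21 (bin .add (bin .mul (reg 19) (reg 2))
      (charA (bin .add (bin .add (reg 10) (bin .mod (load 1 (reg 7)) (reg 14))) (reg 18))))) <|
    seq (ite (load 0 (reg 21)) skip
      (seq (assign 9 (bin .add (reg 9) (lit 1))) (store 0 (reg 21) (reg 9)))) <|
    seq (assign 19 (load 0 (reg 21))) <|
    assign 7 (bin .add (reg 7) (lit 1))

/-- Look up the samples of `B` at offset `y` in the trie. -/
def lookupProg : Prog :=
  seq (assign 19 (reg 17)) <| seq (assign 7 (lit 0)) <|
  .while (bin .lt (reg 7) (reg 16)) <|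
    seq (assign 21 (bin .add (bin .add (reg 10) (bin .mod (load 1 (reg 7)) (reg 14))) (reg 20))) <|
    seq (assign 19 (load 0 (bin .add (bin .mul (reg 19) (reg 2))
      (bin .mul (bin .lt (reg 1) (bin .add (reg 21) (lit 1)))
        (charB (bin .sub (reg 21) (reg 1))))))) <|
    assign 7 (bin .add (reg 7) (lit 1))

end Program

variable {E : Env}

theorem lt_eval_ne_zero {s : State} {e₁ e₂ : Expr} {a b : ℕ} (h₁ : e₁.eval E s = a)
    (h₂ : e₂.eval E s = b) (h : (Expr.bin .lt e₁ e₂).eval E s ≠ 0) : a < b := by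
  by_contra hn
  apply h
  simp [Expr.eval, Op.apply, h₁, h₂, hn]

theorem lt_eval_eq_zero {s : State} {e₁ e₂ : Expr} {a b : ℕ} (hw : 1 < 2 ^ E.w)
    (h₁ : e₁.eval E s = a)
    (h₂ : e₂.eval E s = b) (h : (Expr.bin .lt e₁ e₂).eval E s = 0) : b ≤ a := by
  by_contra hn
  simp only [Expr.eval, Op.apply, h₁, h₂, if_pos (not_le.1 hn), Nat.mod_eq_of_lt hw] at h
  omega

theorem eval_add {s : State} {e₁ e₂ : Expr} {a b : ℕ} (h₁ : e₁.eval E s = a)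
    (h₂ : e₂.eval E s = b) (h : a + b < 2 ^ E.w) : (Expr.bin .add e₁ e₂).eval E s = a + b := by
  simp only [Expr.eval, Op.apply, h₁, h₂, Nat.mod_eq_of_lt h]

theorem eval_mul {s : State} {e₁ e₂ : Expr} {a b : ℕ} (h₁ : e₁.eval E s = a)
    (h₂ : e₂.eval E s = b) (h : a * b < 2 ^ E.w) : (Expr.bin .mul e₁ e₂).eval E s = a * b := by
  simp only [Expr.eval, Op.apply, h₁, h₂, Nat.mod_eq_of_lt h]

theorem eval_sub {s : State} {e₁ e₂ : Expr} {a b : ℕ} (h₁ : e₁.eval E s = a)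
    (h₂ : e₂.eval E s = b) (h : a - b < 2 ^ E.w) : (Expr.bin .sub e₁ e₂).eval E s = a - b := by
  simp only [Expr.eval, Op.apply, h₁, h₂, Nat.mod_eq_of_lt h]

theorem eval_div {s : State} {e₁ e₂ : Expr} {a b : ℕ} (h₁ : e₁.eval E s = a)
    (h₂ : e₂.eval E s = b) (h : a / b < 2 ^ E.w) : (Expr.bin .div e₁ e₂).eval E s = a / b := by
  simp only [Expr.eval, Op.apply, h₁, h₂, Nat.mod_eq_of_lt h]

theorem eval_mod {s : State} {e₁ e₂ : Expr} {a b : ℕ} (h₁ : e₁.eval E s = a)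
    (h₂ : e₂.eval E s = b) (h : a % b < 2 ^ E.w) : (Expr.bin .mod e₁ e₂).eval E s = a % b := by
  simp only [Expr.eval, Op.apply, h₁, h₂, Nat.mod_eq_of_lt h]

theorem eval_lt {s : State} {e₁ e₂ : Expr} {a b : ℕ} (hw : 1 < 2 ^ E.w) (h₁ : e₁.eval E s = a)
    (h₂ : e₂.eval E s = b) : (Expr.bin .lt e₁ e₂).eval E s = if a < b then 1 else 0 := by
  simp only [Expr.eval, Op.apply, h₁, h₂]
  split
  · exact Nat.mod_eq_of_lt hw
  · simp

theorem eval_lit {s : State} {a : ℕ} (h : a < 2 ^ E.w) : (Expr.lit a).eval E s = a :=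
  Nat.mod_eq_of_lt h

theorem eval_load {s : State} {e : Expr} {arr a : ℕ} (h : e.eval E s = a) :
    (Expr.load arr e).eval E s = s.arr arr a := by
  simp only [Expr.eval, h]

theorem eval_charA {s : State} {e : Expr} {a : ℕ} (h : e.eval E s = a) (hb : E.strA a < 2 ^ E.w) :
    (Expr.charA e).eval E s = E.strA a := by
  simp only [Expr.eval, h, Nat.mod_eq_of_lt hb]

theorem eval_charB {s : State} {e : Expr} {a : ℕ} (h : e.eval E s = a) (hb : E.strB a < 2 ^ E.w) :
    (Expr.charB e).eval E s = E.strB a := by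
  simp only [Expr.eval, h, Nat.mod_eq_of_lt hb]

/-- The loop invariant says that `node` is where the first `j` samples lead. Edges are only added
where there was none, so `Extends` holds and strings inserted earlier remain reachable. -/
theorem wp_insertProg {v : Vars} {T R : ℕ → ℕ} {pos : ℕ} {S : Set (List ℕ)}
    (hA : ∀ x, E.strA x < v.s) (hmid : 0 < v.mid)
    (hsz : v.i + v.mid + v.b < 2 ^ E.w)
    (hctr : (v.ctr + v.m + 1) * v.s < 2 ^ E.w)
    (hT : IsTrie T v.s v.root v.ctr S)
    (hS : ∀ j ≤ v.m, pre (fun j => E.strA (v.i + R j % v.mid + v.b)) j ∈ S) :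
    Wp E insertProg (st v T R pos) fun t s' => ∃ T' ctr' j node q,
      s' = st { v with ctr := ctr', j := j, node := node, q := q } T' R pos ∧
      t ≤ 50 * v.m + 20 ∧ ctr' ≤ v.ctr + v.m ∧ IsTrie T' v.s v.root ctr' S ∧ Extends T T' ∧
      walk T' v.s v.root (pre (fun j => E.strA (v.i + R j % v.mid + v.b)) v.m) ≠ 0 := by
  have hw : 1 < 2 ^ E.w := by omega
  have hs0 : 0 < v.s := lt_of_le_of_lt (Nat.zero_le _) (hA 0)
  set f : ℕ → ℕ := fun j => E.strA (v.i + R j % v.mid + v.b) with hf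
  have hfs : ∀ j, f j < v.s := fun j => hA _
  unfold insertProg
  refine .seq_assign rfl (set_node ..) (.seq_assign (eval_lit (by omega)) (set_j ..) ?_)
  refine Wp.while (φ := 50 * v.m) (fun φ s' => ∃ T' ctr' j node q,
      s' = st { v with ctr := ctr', j := j, node := node, q := q } T' R pos ∧ j ≤ v.m ∧
      φ = 50 * (v.m - j) ∧
      ctr' ≤ v.ctr + j ∧ IsTrie T' v.s v.root ctr' S ∧ Extends T T' ∧
      node = walk T' v.s v.root (pre f j) ∧ node ≠ 0)
    ⟨T, v.ctr, 0, v.root, v.q, rfl, by omega, by omega, by omega, hT, fun _ _ => rfl, rfl,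
      hT.root_pos.ne'⟩ ?_ ?_
  · rintro φ _ ⟨T', ctr', j, node, q, rfl, hj, rfl, hc', hT', hext, hnode, hne⟩ hcond
    have hjm : j < v.m := lt_eval_ne_zero rfl rfl hcond
    have hwne : walk T' v.s v.root (pre f j) ≠ 0 := hnode ▸ hne
    obtain ⟨hn1, hn2, -⟩ := hT'.walk_spec (mem_pre_lt hfs) hwne
    rw [← hnode] at hn1 hn2
    have hx := Nat.mod_lt (R j) hmid
    have hmul : node * v.s ≤ (v.ctr + v.m) * v.s := Nat.mul_le_mul_right _ (by omega)
    have hexp : (v.ctr + v.m + 1) * v.s = (v.ctr + v.m) * v.s + v.s := by ring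
    have hfj := hfs j
    have hle : v.ctr + v.m ≤ (v.ctr + v.m) * v.s := Nat.le_mul_of_pos_right _ hs0
    refine .seq_assign (a := node * v.s + f j) (eval_add (eval_mul rfl rfl ?_)
      (eval_charA (a := v.i + R j % v.mid + v.b)
        (eval_add (eval_add rfl (eval_mod rfl rfl ?_) ?_) rfl ?_) ?_) ?_) (set_q ..) ?_
    · show node * v.s < _
      omega
    · show R j % v.mid < _
      omega
    · show v.i + R j % v.mid < _
      omega
    · show v.i + R j % v.mid + v.b < _
      omega
    · show f j < _
      omega
    · show node * v.s + f j < _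
      omega
    -- Both branches of the conditional end with the same two assignments; `c₁` is the time spent in
    -- the branch taken.
    have finish : ∀ (T'' : ℕ → ℕ) (ctr'' c₁ : ℕ), c₁ ≤ 12 → ctr'' ≤ ctr' + 1 →
        IsTrie T'' v.s v.root ctr'' S → Extends T' T'' → T'' (node * v.s + f j) ≠ 0 →
        Wp E (.seq (.assign 19 (.load 0 (.reg 21))) (.assign 7 (.bin .add (.reg 7) (.lit 1))))
          (st { v with ctr := ctr'', j := j, node := node, q := node * v.s + f j } T'' R pos)
          fun t s' => ∃ φ', (∃ T' ctr' j node q,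
            s' = st { v with ctr := ctr', j := j, node := node, q := q } T' R pos ∧ j ≤ v.m ∧
            φ' = 50 * (v.m - j) ∧
            ctr' ≤ v.ctr + j ∧ IsTrie T' v.s v.root ctr' S ∧ Extends T T' ∧
            node = walk T' v.s v.root (pre f j) ∧ node ≠ 0) ∧
            4 + (14 + (c₁ + t)) + φ' ≤ 50 * (v.m - j) := by
      intro T'' ctr'' c₁ hc₁ hctr'' hT'' hext' hne'
      refine .seq_assign (a := T'' (node * v.s + f j)) rfl (set_node ..)
        (.assign (a := j + 1) (eval_add rfl (eval_lit (by omega)) ?_) (set_j ..) ?_)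
      · show j + 1 < _
        omega
      refine ⟨_, ⟨T'', ctr'', j + 1, T'' (node * v.s + f j), node * v.s + f j, rfl, by omega, rfl,
        by omega, hT'', fun a ha => ?_, ?_, hne'⟩, ?_⟩
      · rw [hext' a (by rw [hext a ha]; exact ha), hext a ha]
      · rw [pre_succ, walk_append, hext'.walk_eq hT'.dead (mem_pre_lt hfs) hwne, ← hnode]
      · simp only [Expr.cost]
        omega
    refine .seq (.ite (fun h => .skip ?_) fun h => ?_)
    · exact finish T' ctr' 4 (by omega) (by omega) hT' (fun _ _ => rfl) h
    · refine .seq_assign (a := ctr' + 1) (eval_add rfl (eval_lit (by omega)) ?_) (set_ctr ..)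
        (.store (idx := node * v.s + f j) (a := ctr' + 1) rfl rfl (set_trie ..) ?_)
      · show ctr' + 1 < _
        omega
      have h0 : T' (node * v.s + f j) = 0 := h
      refine finish _ (ctr' + 1) 10 (by omega) (by omega) ?_ ?_ ?_
      · rw [hnode]
        refine hT'.insert (mem_pre_lt hfs) hwne hfj ?_
        rw [← pre_succ]
        exact hS _ hjm
      · intro a ha
        rw [Function.update_of_ne]
        rintro rfl
        exact ha h0
      · rw [Function.update_self]
        omega
  · rintro φ _ t ⟨T', ctr', j, node, q, rfl, hj, -, hc', hT', hext, hnode, hne⟩ hcond ht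
    have hmj : v.m ≤ j := lt_eval_eq_zero hw rfl rfl hcond
    obtain rfl : j = v.m := le_antisymm hj hmj
    refine ⟨T', ctr', v.m, node, q, rfl, ?_, hc', hT', hext, hnode ▸ hne⟩
    simp only [Expr.cost] at ht ⊢
    omega

/-- The loop runs to the end even when the walk dies, since node `0` absorbs it; the final `node`
alone tells whether the string was found. -/
theorem wp_lookupProg {v : Vars} {T R : ℕ → ℕ} {pos : ℕ} {S : Set (List ℕ)}
    (hB : ∀ x, E.strB x < v.s) (hmid : 0 < v.mid)
    (hsz : v.i + v.mid + v.y < 2 ^ E.w) (hm : v.m + 1 < 2 ^ E.w)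
    (hctr : (v.ctr + 1) * v.s < 2 ^ E.w)
    (hT : IsTrie T v.s v.root v.ctr S) :
    Wp E lookupProg (st v T R pos) fun t s' => ∃ j q,
      s' = st { v with j := j, q := q, node := (walk T v.s v.root
        (pre (fun j => shiftBy v.k E.strB (v.i + R j % v.mid + v.y)) v.m)) } T R pos ∧
      t ≤ 50 * v.m + 20 := by
  have hw : 1 < 2 ^ E.w := by omega
  have hs0 : 0 < v.s := lt_of_le_of_lt (Nat.zero_le _) (hB 0)
  set f : ℕ → ℕ := fun j => shiftBy v.k E.strB (v.i + R j % v.mid + v.y) with hf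
  have hfs : ∀ j, f j < v.s := fun j => by
    simp only [hf, shiftBy]
    split
    · exact hB _
    · exact hs0
  unfold lookupProg
  refine .seq_assign rfl (set_node ..) (.seq_assign (eval_lit (by omega)) (set_j ..) ?_)
  refine Wp.while (φ := 50 * v.m) (fun φ s' => ∃ j q,
      s' = st { v with j := j, q := q, node := walk T v.s v.root (pre f j) } T R pos ∧ j ≤ v.m ∧
      φ = 50 * (v.m - j))
    ⟨0, v.q, rfl, by omega, by omega⟩ ?_ ?_
  · rintro φ _ ⟨j, q, rfl, hj, rfl⟩ hcond
    have hjm : j < v.m := lt_eval_ne_zero rfl rfl hcond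
    have hnle : walk T v.s v.root (pre f j) ≤ v.ctr := by
      by_cases h0 : walk T v.s v.root (pre f j) = 0
      · omega
      · exact (hT.walk_spec (mem_pre_lt hfs) h0).2.1
    set node := walk T v.s v.root (pre f j) with hnode
    have hx := Nat.mod_lt (R j) hmid
    have hmul : node * v.s ≤ v.ctr * v.s := Nat.mul_le_mul_right _ (by omega)
    have hexp : (v.ctr + 1) * v.s = v.ctr * v.s + v.s := by ring
    have hfj := hfs j
    have hBq := hB (v.i + R j % v.mid + v.y - v.k)
    -- In front of `B` the truncated subtraction would read position `0`; multiplying by the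
    -- comparison bit turns this into the sentinel.
    have hch : f j = (if v.k < v.i + R j % v.mid + v.y + 1 then 1 else 0) *
        E.strB (v.i + R j % v.mid + v.y - v.k) := by
      simp only [hf, shiftBy, Nat.lt_succ_iff]
      split <;> simp
    refine .seq_assign (a := v.i + R j % v.mid + v.y)
      (eval_add (eval_add rfl (eval_mod rfl rfl ?_) ?_) rfl ?_) (set_q ..) ?_
    · show R j % v.mid < _
      omega
    · show v.i + R j % v.mid < _
      omega
    · show v.i + R j % v.mid + v.y < _
      omega
    refine .seq_assign (a := T (node * v.s + f j)) (eval_load (eval_add (eval_mul rfl rfl ?_)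
      ((eval_mul (eval_lt hw rfl (eval_add rfl (eval_lit hw) ?_))
        (eval_charB (eval_sub rfl rfl ?_) ?_) ?_).trans hch.symm) ?_)) (set_node ..) ?_
    · show node * v.s < _
      omega
    · show v.i + R j % v.mid + v.y + 1 < _
      omega
    · show v.i + R j % v.mid + v.y - v.k < _
      omega
    · show E.strB (v.i + R j % v.mid + v.y - v.k) < _
      omega
    · refine lt_of_eq_of_lt hch.symm ?_
      omega
    · show node * v.s + f j < _
      omega
    refine .assign (a := j + 1) (eval_add rfl (eval_lit (by omega)) ?_) (set_j ..) ?_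
    · show j + 1 < _
      omega
    refine ⟨_, ⟨j + 1, v.i + R j % v.mid + v.y, ?_, by omega, rfl⟩, ?_⟩
    · rw [pre_succ, walk_append]
    · simp only [Expr.cost]
      omega
  · rintro φ _ t ⟨j, q, rfl, hj, -⟩ hcond ht
    have hmj : v.m ≤ j := lt_eval_eq_zero hw rfl rfl hcond
    obtain rfl : j = v.m := le_antisymm hj hmj
    refine ⟨v.m, q, rfl, ?_⟩
    simp only [Expr.cost] at ht ⊢
    omega

end GapED

/-! ### The complete window test: baby steps and giant steps -/

namespace GapED

open WordRAM

section Program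

open Expr Prog

/-- Test whether some diagonal agrees with the window of length `mid` at `i` on all samples. -/
def testProg : Prog :=
  seq (assign 16 (bin .mul (bin .add (bin .div (reg 14) (reg 1)) (lit 1)) (reg 4))) <|
  seq (assign 9 (bin .add (reg 9) (lit 1))) <|
  seq (assign 17 (reg 9)) <|
  seq (assign 18 (lit 0)) <|
  seq (.while (bin .lt (reg 18) (reg 3)) <|
    seq insertProg (assign 18 (bin .add (reg 18) (lit 1)))) <|
  seq (assign 15 (lit 0)) <|
  seq (assign 20 (lit 0)) <|
  .while (bin .lt (reg 20) (bin .add (bin .add (reg 1) (reg 1)) (reg 3))) <|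
    seq lookupProg <|
    seq (ite (reg 19) (assign 15 (lit 1)) skip) <|
    assign 20 (bin .add (reg 20) (reg 3))

end Program

variable {E : Env}

/-- The baby steps. `S` consists of all prefixes of the `r` sample strings, because intermediate
nodes carry labels as well. -/
theorem wp_insertAll {v : Vars} {T R : ℕ → ℕ} {pos : ℕ}
    (hA : ∀ x, E.strA x < v.s) (hmid : 0 < v.mid)
    (hsz : v.i + v.mid + v.r < 2 ^ E.w)
    (hctr : (v.ctr + v.r * v.m + 1) * v.s < 2 ^ E.w) (hb : v.b = 0)
    (hT : IsTrie T v.s v.root v.ctr {l | ∃ b < v.r, ∃ j,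
      l = pre (fun j => E.strA (v.i + R j % v.mid + b)) j}) :
    Wp E (.while (.bin .lt (.reg 18) (.reg 3)) <|
      .seq insertProg (.assign 18 (.bin .add (.reg 18) (.lit 1)))) (st v T R pos)
      fun t s' => ∃ T' ctr' j node q b,
      s' = st { v with ctr := ctr', j := j, node := node, q := q, b := b } T' R pos ∧
      t ≤ v.r * (50 * v.m + 40) + 4 ∧ ctr' ≤ v.ctr + v.r * v.m ∧
      IsTrie T' v.s v.root ctr' {l | ∃ b < v.r, ∃ j,
        l = pre (fun j => E.strA (v.i + R j % v.mid + b)) j} ∧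
      ∀ b < v.r,
        walk T' v.s v.root (pre (fun j => E.strA (v.i + R j % v.mid + b)) v.m) ≠ 0 := by
  set S : Set (List ℕ) := {l | ∃ b < v.r, ∃ j,
      l = pre (fun j => E.strA (v.i + R j % v.mid + b)) j} with hS
  have hw : 1 < 2 ^ E.w := by omega
  refine Wp.while (φ := v.r * (50 * v.m + 40)) (fun φ s' => ∃ T' ctr' j node q b,
      s' = st { v with ctr := ctr', j := j, node := node, q := q, b := b } T' R pos ∧ b ≤ v.r ∧
      φ = (v.r - b) * (50 * v.m + 40) ∧ ctr' ≤ v.ctr + b * v.m ∧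
      IsTrie T' v.s v.root ctr' S ∧
      ∀ b' < b, walk T' v.s v.root (pre (fun j => E.strA (v.i + R j % v.mid + b')) v.m) ≠ 0)
    ⟨T, v.ctr, v.j, v.node, v.q, 0, by rw [← hb], by omega, by simp, by omega, hT, by simp⟩ ?_ ?_
  · rintro φ _ ⟨T', ctr', j, node, q, b, rfl, hbr, rfl, hc', hT', hwalk⟩ hcond
    have hlt : b < v.r := lt_eval_ne_zero rfl rfl hcond
    have hmul : (b + 1) * v.m ≤ v.r * v.m := Nat.mul_le_mul_right _ hlt
    have hbm : (b + 1) * v.m = b * v.m + v.m := by ring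
    refine .seq (Wp.mono (wp_insertProg (S := S)
      (v := { v with ctr := ctr', j := j, node := node, q := q, b := b }) hA hmid ?_ ?_ hT' ?_) ?_)
    · show v.i + v.mid + b < _
      omega
    · show (ctr' + v.m + 1) * v.s < _
      exact lt_of_le_of_lt (Nat.mul_le_mul_right _ (by omega)) hctr
    · exact fun j _ => ⟨b, hlt, j, rfl⟩
    rintro t _ ⟨T'', ctr'', j', node', q', rfl, ht, hctr'', hT'', hext, hne⟩
    refine .assign (a := b + 1) (eval_add rfl (eval_lit (by omega)) ?_) (set_b ..) ?_
    · show b + 1 < _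
      omega
    refine ⟨_, ⟨T'', ctr'', j', node', q', b + 1, rfl, by omega, rfl, ?_, hT'', ?_⟩, ?_⟩
    · replace hctr'' : ctr'' ≤ ctr' + v.m := hctr''
      omega
    · intro b' hb'
      rcases Nat.lt_succ_iff_lt_or_eq.1 hb' with h | rfl
      · rw [hext.walk_eq hT'.dead (mem_pre_lt fun j => hA _) (hwalk b' h)]
        exact hwalk b' h
      · exact hne
    · replace ht : t ≤ 50 * v.m + 20 := ht
      have : v.r - b = (v.r - (b + 1)) + 1 := by omega
      rw [this, Nat.add_mul (v.r - (b + 1))]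
      simp only [Expr.cost]
      omega
  · rintro φ _ t ⟨T', ctr', j, node, q, b, rfl, hbr, -, hc', hT', hwalk⟩ hcond ht
    have hle : v.r ≤ b := lt_eval_eq_zero hw rfl rfl hcond
    obtain rfl : b = v.r := le_antisymm hbr hle
    exact ⟨T', ctr', j, node, q, _, rfl, ht, hc', hT', hwalk⟩

/-- The giant steps. The loop does not stop at a success but only raises the flag `ok`, so that its
time does not depend on the outcome. -/
theorem wp_lookupAll {v : Vars} {T R : ℕ → ℕ} {pos : ℕ} {S : Set (List ℕ)}
    (hB : ∀ x, E.strB x < v.s) (hmid : 0 < v.mid) (hr : v.k < v.r * v.r)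
    (hsz : v.i + v.mid + 2 * v.k + 2 * v.r < 2 ^ E.w) (hm : v.m + 1 < 2 ^ E.w)
    (hctr : (v.ctr + 1) * v.s < 2 ^ E.w) (hy : v.y = 0) (hok : v.ok = 0)
    (hT : IsTrie T v.s v.root v.ctr S) :
    Wp E (.while (.bin .lt (.reg 20) (.bin .add (.bin .add (.reg 1) (.reg 1)) (.reg 3))) <|
      .seq lookupProg <| .seq (.ite (.reg 19) (.assign 15 (.lit 1)) .skip) <|
      .assign 20 (.bin .add (.reg 20) (.reg 3))) (st v T R pos)
      fun t s' => ∃ j node q y ok,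
      s' = st { v with j := j, node := node, q := q, y := y, ok := ok } T R pos ∧
      t ≤ (2 * v.r + 1) * (50 * v.m + 50) + 8 ∧
      (ok ≠ 0 ↔ ∃ a, a * v.r < 2 * v.k + v.r ∧ walk T v.s v.root
        (pre (fun j => shiftBy v.k E.strB (v.i + R j % v.mid + a * v.r)) v.m) ≠ 0) := by
  have hw : 1 < 2 ^ E.w := by omega
  have hr0 : 0 < v.r := by
    rcases Nat.eq_zero_or_pos v.r with h | h
    · simp [h] at hr
    · exact h
  have hv : v = { v with y := 0, ok := 0 } := by
    cases v; simp_all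
  have hsum : ∀ v' : Vars, v'.k = v.k → v'.r = v.r →
      (Expr.bin .add (.bin .add (.reg 1) (.reg 1)) (.reg 3)).eval E (st v' T R pos) =
        v.k + v.k + v.r := by
    intro v' h1 h2
    rw [← h1, ← h2]
    refine eval_add (eval_add rfl rfl ?_) rfl ?_
    · show v'.k + v'.k < _
      omega
    · show v'.k + v'.k + v'.r < _
      omega
  refine Wp.while (φ := (2 * v.r + 1) * (50 * v.m + 50)) (fun φ s' => ∃ j node q y ok a,
      s' = st { v with j := j, node := node, q := q, y := y, ok := ok } T R pos ∧
      y = a * v.r ∧ y < 2 * v.k + 2 * v.r ∧ φ = (2 * v.r + 1 - a) * (50 * v.m + 50) ∧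
      (ok ≠ 0 ↔ ∃ a' < a, walk T v.s v.root
        (pre (fun j => shiftBy v.k E.strB (v.i + R j % v.mid + a' * v.r)) v.m) ≠ 0))
    ⟨v.j, v.node, v.q, 0, 0, 0, congrArg (st · T R pos) hv, by simp, by omega, by simp, by simp⟩
    ?_ ?_
  · rintro φ _ ⟨j, node, q, y, ok, a, rfl, hya, hylt, rfl, hiff⟩ hcond
    have hlt : y < v.k + v.k + v.r := lt_eval_ne_zero rfl (by exact hsum _ rfl rfl) hcond
    -- Here `k < r * r` enters: the multiples of `r` below `2 * k + r` number at most `2 * r + 1`.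
    have ha : a < 2 * v.r + 1 := by
      by_contra hge
      have : (2 * v.r + 1) * v.r ≤ a * v.r := Nat.mul_le_mul_right _ (by omega)
      have e : (2 * v.r + 1) * v.r = v.r * v.r + v.r * v.r + v.r := by ring
      omega
    refine .seq (Wp.mono (wp_lookupProg (S := S)
      (v := { v with j := j, node := node, q := q, y := y, ok := ok }) hB hmid ?_ hm hctr hT) ?_)
    · show v.i + v.mid + y < _
      omega
    rintro t _ ⟨j', q', rfl, ht⟩
    replace ht : t ≤ 50 * v.m + 20 := ht
    set nd := walk T v.s v.root
      (pre (fun j => shiftBy v.k E.strB (v.i + R j % v.mid + y)) v.m) with hnd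
    have finish : ∀ ok' c, c ≤ 10 → (ok' ≠ 0 ↔ ok ≠ 0 ∨ nd ≠ 0) →
        Wp E (.assign 20 (.bin .add (.reg 20) (.reg 3)))
        (st { v with j := j', node := nd, q := q', y := y, ok := ok' } T R pos)
        fun t' s' => ∃ φ', (∃ j node q y ok a,
          s' = st { v with j := j, node := node, q := q, y := y, ok := ok } T R pos ∧
          y = a * v.r ∧ y < 2 * v.k + 2 * v.r ∧ φ' = (2 * v.r + 1 - a) * (50 * v.m + 50) ∧
          (ok ≠ 0 ↔ ∃ a' < a, walk T v.s v.root
            (pre (fun j => shiftBy v.k E.strB (v.i + R j % v.mid + a' * v.r)) v.m) ≠ 0)) ∧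
          8 + (t + (c + t')) + φ' ≤ (2 * v.r + 1 - a) * (50 * v.m + 50) := by
      intro ok' c hc hok'
      refine .assign (a := y + v.r) (eval_add rfl rfl ?_) (set_y ..) ?_
      · show y + v.r < _
        omega
      refine ⟨_, ⟨j', nd, q', y + v.r, ok', a + 1, rfl, by rw [hya]; ring, by omega, rfl, ?_⟩, ?_⟩
      · rw [hok', hiff]
        constructor
        · rintro (⟨a', ha', h⟩ | h)
          · exact ⟨a', by omega, h⟩
          · exact ⟨a, by omega, by rw [← hya]; exact h⟩
        · rintro ⟨a', ha', h⟩
          rcases Nat.lt_succ_iff_lt_or_eq.1 ha' with h' | rfl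
          · exact .inl ⟨a', h', h⟩
          · right; rw [hnd, hya]; exact h
      · have : 2 * v.r + 1 - a = (2 * v.r + 1 - (a + 1)) + 1 := by omega
        rw [this, Nat.add_mul (2 * v.r + 1 - (a + 1))]
        simp only [Expr.cost]
        omega
    refine .seq (.ite (fun h => .assign (a := 1) (eval_lit hw) (set_ok ..) ?_) fun h => .skip ?_)
    · exact finish 1 4 (by omega) (by simp [show nd ≠ 0 from h])
    · exact finish ok 3 (by omega) (by simp [show nd = 0 from h])
  · rintro φ _ t ⟨j, node, q, y, ok, a, rfl, hya, hylt, -, hiff⟩ hcond ht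
    have hle : v.k + v.k + v.r ≤ y := lt_eval_eq_zero hw rfl (by exact hsum _ rfl rfl) hcond
    refine ⟨j, node, q, y, ok, rfl, ht, hiff.trans ⟨?_, ?_⟩⟩
    · rintro ⟨a', ha', h⟩
      refine ⟨a', ?_, h⟩
      have : (a' + 1) * v.r ≤ a * v.r := Nat.mul_le_mul_right _ ha'
      have e : (a' + 1) * v.r = a' * v.r + v.r := by ring
      omega
    · rintro ⟨a', ha', h⟩
      refine ⟨a', ?_, h⟩
      by_contra hge
      have : a * v.r ≤ a' * v.r := Nat.mul_le_mul_right _ (by omega)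
      omega

/-- The registers that a search preserves. -/
structure Base (v u : Vars) : Prop where
  n_eq : u.n = v.n
  k_eq : u.k = v.k
  s_eq : u.s = v.s
  r_eq : u.r = v.r
  L_eq : u.L = v.L
  i_eq : u.i = v.i
  g_eq : u.g = v.g

/-- The registers that a test preserves. -/
structure Same (v u : Vars) : Prop extends Base v u where
  lo_eq : u.lo = v.lo
  hi_eq : u.hi = v.hi
  mid_eq : u.mid = v.mid

/-- The test decides `PassStr` without error for the given samples; randomness matters only later,
for what passing says about the strings. -/
theorem wp_testProg {v : Vars} {T R : ℕ → ℕ} {pos : ℕ}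
    (hA : ∀ x, E.strA x < v.s) (hB : ∀ x, E.strB x < v.s) (hmid : 0 < v.mid)
    (hr : v.k < v.r * v.r) (hL : 0 < v.L)
    (hsz : v.i + v.mid + 2 * v.k + 2 * v.r < 2 ^ E.w)
    (hm : numSamples v.k v.L v.mid + 1 < 2 ^ E.w)
    (hctr : (v.ctr + v.r * numSamples v.k v.L v.mid + 2) * v.s < 2 ^ E.w)
    (hT : Blank T v.s v.ctr) :
    Wp E testProg (st v T R pos) fun t s' => ∃ v' T',
      s' = st v' T' R pos ∧ Same v v' ∧
      t ≤ 500 * (v.r * numSamples v.k v.L v.mid) ∧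
      v'.ctr ≤ v.ctr + v.r * numSamples v.k v.L v.mid + 1 ∧ Blank T' v.s v'.ctr ∧
      (v'.ok ≠ 0 ↔ PassStr E.strA E.strB v.k v.r v.L R v.i v.mid) := by
  have hw : 1 < 2 ^ E.w := by omega
  have hr0 : 0 < v.r := by
    rcases Nat.eq_zero_or_pos v.r with h | h
    · simp [h] at hr
    · exact h
  have hs0 : 0 < v.s := lt_of_le_of_lt (Nat.zero_le _) (hA 0)
  set m := numSamples v.k v.L v.mid with hmdef
  have hm1 : v.mid / v.k + 1 ≤ m := Nat.le_mul_of_pos_right _ hL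
  have hm0 : 1 ≤ m := le_trans (Nat.le_add_left 1 _) hm1
  have hc1 : v.ctr + v.r * m + 2 ≤ (v.ctr + v.r * m + 2) * v.s := Nat.le_mul_of_pos_right _ hs0
  have hrm : 1 ≤ v.r * m := Nat.mul_pos hr0 (by omega)
  have hrm2 : v.r ≤ v.r * m := Nat.le_mul_of_pos_right _ (by omega)
  have hrm3 : m ≤ v.r * m := Nat.le_mul_of_pos_left _ hr0
  unfold testProg
  refine .seq_assign (a := m) (eval_mul (eval_add (eval_div rfl rfl ?_) (eval_lit hw) ?_) rfl ?_)
    (set_m ..) ?_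
  · exact (Nat.lt_of_succ_le hm1).trans (by omega)
  · exact lt_of_le_of_lt hm1 (by omega)
  · show m < _
    omega
  refine .seq_assign (a := v.ctr + 1) (eval_add rfl (eval_lit hw) ?_) (set_ctr ..) ?_
  · show v.ctr + 1 < _
    omega
  refine .seq_assign (a := v.ctr + 1) rfl (set_root ..) ?_
  refine .seq_assign (a := 0) (eval_lit (by omega)) (set_b ..) ?_
  refine .seq (Wp.mono (wp_insertAll
    (v := { v with m := m, ctr := v.ctr + 1, root := v.ctr + 1, b := 0 })
    hA hmid ?_ ?_ rfl (hT.isTrie _)) ?_)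
  · show v.i + v.mid + v.r < _
    omega
  · show (v.ctr + 1 + v.r * m + 1) * v.s < _
    rwa [show v.ctr + 1 + v.r * m + 1 = v.ctr + v.r * m + 2 by ring]
  rintro t₁ _ ⟨T', ctr', j, node, q, b, rfl, ht₁, hc', hT', hwalk⟩
  replace ht₁ : t₁ ≤ v.r * (50 * m + 40) + 4 := ht₁
  replace hc' : ctr' ≤ v.ctr + 1 + v.r * m := hc'
  refine .seq_assign (a := 0) (eval_lit (by omega)) (set_ok ..) ?_
  refine .seq_assign (a := 0) (eval_lit (by omega)) (set_y ..) ?_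
  refine Wp.mono (wp_lookupAll
    (v := { v with m := m, ctr := ctr', root := v.ctr + 1, b := b, j := j, node := node, q := q,
                   ok := 0, y := 0 })
    hB hmid hr hsz hm ?_ rfl rfl hT') ?_
  · show (ctr' + 1) * v.s < _
    exact lt_of_le_of_lt (Nat.mul_le_mul_right _ (by omega)) hctr
  rintro t₂ _ ⟨j', node', q', y', ok', rfl, ht₂, hiff⟩
  replace ht₂ : t₂ ≤ (2 * v.r + 1) * (50 * m + 50) + 8 := ht₂
  refine ⟨_, T', rfl, ⟨⟨rfl, rfl, rfl, rfl, rfl, rfl, rfl⟩, rfl, rfl, rfl⟩, ?_, ?_, hT'.toBlank, ?_⟩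
  · simp only [Expr.cost]
    have e1 : v.r * (50 * m + 40) = 50 * (v.r * m) + 40 * v.r := by ring
    have e2 : (2 * v.r + 1) * (50 * m + 50) = 100 * (v.r * m) + 100 * v.r + 50 * m + 50 := by ring
    omega
  · show ctr' ≤ _
    omega
  · refine Iff.trans (hiff : ok' ≠ 0 ↔ _) ?_
    have hfB : ∀ a j, shiftBy v.k E.strB (v.i + R j % v.mid + a * v.r) < v.s := by
      intro a j
      unfold shiftBy
      split
      · exact hB _
      · exact hs0
    constructor
    · rintro ⟨a, ha, hne⟩
      -- A lookup that survives has found a prefix of an inserted string. As the lookup has length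
      -- `m > 0`, comparing lengths gives `j = m`, a match on all samples.
      obtain ⟨b, hb, j, heq⟩ := (hT'.walk_spec (mem_pre_lt fun j => hfB a j) hne).2.2 (by
        intro h0
        have := congrArg List.length h0
        rw [length_pre] at this
        replace this : m = 0 := this
        omega)
      have hlen := congrArg List.length heq
      rw [length_pre, length_pre] at hlen
      subst hlen
      exact ⟨b, hb, a, ha, fun j hj => (pre_eq_pre_iff.1 heq j hj).symm⟩
    · rintro ⟨b, hb, a, ha, heq⟩
      refine ⟨a, ha, ?_⟩
      rw [← pre_eq_pre_iff.2 heq]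
      exact hwalk b hb

end GapED

/-! ### The search for a window length, and one greedy round -/

namespace GapED

open WordRAM

/-- The rule for loops, with an invariant `I τ μ s` in terms of the elapsed time `τ` and a
decreasing measure `μ`. -/
theorem Wp.while_elapsed {E : Env} {P : Prog} {s : State} {Q : ℕ → State → Prop} {e : Expr}
    (I : ℕ → ℕ → State → Prop) {τ μ : ℕ} (h0 : I τ μ s)
    (hstep : ∀ τ μ s, I τ μ s → e.eval E s ≠ 0 →
      Wp E P s fun t s' => ∃ μ' < μ, I (τ + (e.cost + 1 + t)) μ' s')
    (hend : ∀ τ' μ' s', I τ' μ' s' → e.eval E s' = 0 →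
      ∀ t, τ + t = τ' + (e.cost + 1) → Q t s') :
    Wp E (.while e P) s Q := by
  induction μ using Nat.strong_induction_on generalizing s Q τ with
  | _ μ ih =>
    by_cases h : e.eval E s = 0
    · exact ⟨_, _, .whileFalse h, hend τ μ s h0 h _ rfl⟩
    · obtain ⟨t, s', hex, μ', hlt, hI⟩ := hstep τ μ s h0 h
      obtain ⟨t₂, s₂, hex₂, hq⟩ := ih μ' hlt hI
        (Q := fun t₂ s₂ => Q (e.cost + 1 + t + t₂) s₂)
        (fun τ' μ' s₂ hI₂ h₂ t₂ ht => hend τ' μ' s₂ hI₂ h₂ _ (by omega))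
      exact ⟨_, _, .whileTrue h hex hex₂, hq⟩

section Program

open Expr Prog

/-- Move one end of the search interval to `mid`, as the test says. -/
def updateProg : Prog := seq testProg (ite (reg 15) (assign 12 (reg 14)) (assign 13 (reg 14)))

/-- One greedy round. -/
def roundProg : Prog :=
  seq (assign 12 (lit 0)) <|
  seq (assign 13 (bin .sub (bin .add (reg 0) (lit 1)) (bin .add (reg 10) (reg 3)))) <|
  seq (.while (bin .lt (bin .add (reg 12) (lit 1)) (reg 13)) <|
    seq (assign 14 (bin .add (bin .add (reg 12) (reg 12)) (lit 1))) <|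
    seq (ite (bin .lt (bin .div (bin .add (reg 12) (reg 13)) (lit 2)) (reg 14))
      (assign 14 (bin .div (bin .add (reg 12) (reg 13)) (lit 2))) skip) <|
    updateProg) <|
  seq (assign 10 (bin .add (bin .add (bin .add (reg 10) (reg 12)) (lit 1)) (reg 3))) <|
  assign 11 (bin .add (reg 11) (lit 1))

end Program

theorem numSamples_mono (k L : ℕ) {l l' : ℕ} (h : l ≤ l') :
    numSamples k L l ≤ numSamples k L l' :=
  Nat.mul_le_mul_right _ (Nat.add_le_add_right (Nat.div_le_div_right h) _)

theorem numSamples_pos (k l : ℕ) {L : ℕ} (h : 0 < L) : 0 < numSamples k L l :=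
  Nat.mul_pos (Nat.succ_pos _) h

variable {n σ : ℕ} {A B : Fin n → Fin σ} {E : Env}

/-- State of the search in a round that starts in `v`: elapsed time `τ` and remaining number of
tests `μ`. -/
structure Search (A B : Fin n → Fin σ) (R : ℕ → ℕ) (e : ℕ) (v v' : Vars) (T' : ℕ → ℕ) (τ μ : ℕ) :
    Prop extends Base v v' where
  lo_spec : v'.lo = 0 ∨ v.i + v'.lo + v.r ≤ n ∧ Pass A B v.k v.r v.L R v.i v'.lo
  hi_spec : v'.hi = n + 1 - (v.i + v.r) ∨ 0 < v'.hi ∧ ¬ Pass A B v.k v.r v.L R v.i v'.hi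
  hi_le : v'.hi ≤ n + 1 - (v.i + v.r)
  lo_lt : v'.lo = 0 ∨ v'.lo < v'.hi
  fuel : ∃ a b, μ = a + b ∧ v'.hi - v'.lo ≤ 2 ^ a ∧ 2 ^ e ≤ (v'.lo + 1) * 2 ^ b
  fuel_le : μ ≤ 2 * e
  time : τ ≤ (2 * e - μ) * (600 * (v.r * numSamples v.k v.L (2 * v'.lo + 1)))
  ctr_le : v'.ctr ≤ v.ctr + (2 * e - μ) * (v.r * numSamples v.k v.L n + 1)
  blank : Blank T' v.s v'.ctr

/-- Passing need not be monotone in the length; the search only keeps a good lower end and a bad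
upper end. In the fuel `a + b`, `a` bounds the logarithm of the gap and `b` counts doublings of `lo
+ 1`. A pass at `2 * lo + 1` lowers `b`; a pass at the midpoint, or any failure, halves the gap and
lowers `a`. As `mid ≤ 2 * lo + 1`, the elapsed time is bounded in terms of the current `lo`, which
never decreases. The slack `c` pays for the surrounding loop. -/
theorem wp_updateProg (hEA : E.strA = readString A) (hEB : E.strB = readString B)
    {R : ℕ → ℕ} {pos e τ μ mid : ℕ} {v v' : Vars} {T' : ℕ → ℕ}
    (hs : v.s = σ + 1) (hr : v.k < v.r * v.r) (hL : 0 < v.L)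
    (hne : n < 2 ^ e)
    (hsz : n + 2 * v.k + 2 * v.r + 1 < 2 ^ E.w)
    (hm : numSamples v.k v.L n + 1 < 2 ^ E.w)
    (hctr : (v.ctr + 2 * e * (v.r * numSamples v.k v.L n + 1) + 2) * v.s < 2 ^ E.w)
    (h : Search A B R e v v' T' τ μ) (hlt : v'.lo + 1 < v'.hi) (hmid : v'.mid = mid)
    (hmid' : mid = 2 * v'.lo + 1 ∨ mid = (v'.lo + v'.hi) / 2) (h1 : mid ≤ 2 * v'.lo + 1)
    (h2 : 2 * mid ≤ v'.lo + v'.hi) (h3 : v'.lo < mid) :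
    Wp E updateProg (st v' T' R pos) fun t s' => ∃ v'' T'' μ', s' = st v'' T'' R pos ∧ μ' < μ ∧
      ∀ c ≤ 50, Search A B R e v v'' T'' (τ + (c + t)) μ' := by
  have hr0 : 0 < v.r := by
    rcases Nat.eq_zero_or_pos v.r with h | h
    · simp [h] at hr
    · exact h
  obtain ⟨hb, hlo, hhi, hhile, -, ⟨a, b, rfl, ha, hb'⟩, hfuel, htime, hctr', hblank⟩ := h
  have hmidn : v.i + mid + v.r ≤ n := by omega
  have hns : numSamples v.k v.L mid ≤ numSamples v.k v.L n := numSamples_mono _ _ (by omega)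
  have hnsr : v.r * numSamples v.k v.L mid ≤ v.r * numSamples v.k v.L n :=
    Nat.mul_le_mul_left _ hns
  have ha1 : a ≠ 0 := by
    rintro rfl
    simp at ha
    omega
  -- With `b = 0` one would have `lo + 1 ≥ 2 ^ e > n`, too long for a search that is still open.
  have hb1 : b ≠ 0 := by
    rintro rfl
    omega
  have hstep : 2 * e - (a + b - 1) = (2 * e - (a + b)) + 1 := by omega
  have hexp : (2 * e - (a + b) + 1) * (v.r * numSamples v.k v.L n + 1) ≤
      2 * e * (v.r * numSamples v.k v.L n + 1) := Nat.mul_le_mul_right _ (by omega)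
  rw [Nat.add_mul _ 1 (v.r * numSamples v.k v.L n + 1)] at hexp
  refine .seq (Wp.mono (wp_testProg (R := R) (T := T') ?_ ?_ ?_ ?_ ?_ ?_ ?_ ?_ ?_) ?_)
  · rw [hEA, hb.s_eq, hs]
    exact fun x => Nat.lt_succ_of_le (readString_le A x)
  · rw [hEB, hb.s_eq, hs]
    exact fun x => Nat.lt_succ_of_le (readString_le B x)
  · omega
  · rw [hb.k_eq, hb.r_eq]; exact hr
  · rw [hb.L_eq]; exact hL
  · rw [hb.i_eq, hb.k_eq, hb.r_eq, hmid]
    omega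
  · rw [hb.k_eq, hb.L_eq, hmid]
    omega
  · rw [hb.k_eq, hb.L_eq, hb.r_eq, hmid, hb.s_eq]
    exact lt_of_le_of_lt (Nat.mul_le_mul_right _ (by omega)) hctr
  · rw [hb.s_eq]; exact hblank
  rintro t _ ⟨v₁, T₁, rfl, hsame, ht, hc₁, hbl₁, hok⟩
  rw [hb.k_eq, hb.L_eq, hb.r_eq, hmid] at ht hc₁
  rw [hb.k_eq, hb.L_eq, hb.r_eq, hmid, hb.i_eq, hEA, hEB] at hok
  rw [hb.s_eq] at hbl₁
  have hpos : 1 ≤ v.r * numSamples v.k v.L mid := Nat.mul_pos hr0 (numSamples_pos _ _ hL)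
  have hc₂ : v₁.ctr ≤ v.ctr + (2 * e - (a + b - 1)) * (v.r * numSamples v.k v.L n + 1) := by
    rw [hstep, Nat.add_mul]
    omega
  -- A test takes at most 500 units; the coefficient 600 leaves 100 for bookkeeping, since a unit is
  -- at least one step.
  have htm : ∀ lo' : ℕ, v'.lo ≤ lo' → ∀ c ≤ 60, τ + (c + t) ≤
      (2 * e - (a + b - 1)) * (600 * (v.r * numSamples v.k v.L (2 * lo' + 1))) := by
    intro lo' hlo' c hc
    have e1 : v.r * numSamples v.k v.L (2 * v'.lo + 1) ≤
        v.r * numSamples v.k v.L (2 * lo' + 1) :=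
      Nat.mul_le_mul_left _ (numSamples_mono _ _ (by omega))
    have e2 : v.r * numSamples v.k v.L mid ≤ v.r * numSamples v.k v.L (2 * lo' + 1) :=
      Nat.mul_le_mul_left _ (numSamples_mono _ _ (by omega))
    have e3 : (2 * e - (a + b)) * (600 * (v.r * numSamples v.k v.L (2 * v'.lo + 1))) ≤
        (2 * e - (a + b)) * (600 * (v.r * numSamples v.k v.L (2 * lo' + 1))) :=
      Nat.mul_le_mul_left _ (Nat.mul_le_mul_left _ e1)
    rw [hstep, Nat.add_mul]
    omega
  have hbase : Base v v₁ := ⟨hsame.n_eq.trans hb.n_eq, hsame.k_eq.trans hb.k_eq, hsame.s_eq.trans hb.s_eq,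
    hsame.r_eq.trans hb.r_eq, hsame.L_eq.trans hb.L_eq, hsame.i_eq.trans hb.i_eq, hsame.g_eq.trans hb.g_eq⟩
  have hpow : 2 ^ a = 2 ^ (a - 1) + 2 ^ (a - 1) := by
    rw [← two_mul, ← pow_succ']; congr 1; omega
  refine .ite (fun h => .assign (a := mid) (hsame.mid_eq.trans hmid) (set_lo ..) ?_)
    (fun h => .assign (a := mid) (hsame.mid_eq.trans hmid) (set_hi ..) ?_)
  · have hpass := hok.1 h
    refine ⟨_, T₁, a + b - 1, rfl, by omega, fun c hc =>
      ⟨⟨hbase.n_eq, hbase.k_eq, hbase.s_eq, hbase.r_eq, hbase.L_eq, hbase.i_eq, hbase.g_eq⟩, .inr ⟨hmidn, hpass⟩,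
        ?_, ?_, .inr ?_, ?_, by omega, ?_, hc₂, hbl₁⟩⟩
    · show v₁.hi = _ ∨ 0 < v₁.hi ∧ ¬ Pass A B v.k v.r v.L R v.i v₁.hi
      rw [hsame.hi_eq]; exact hhi
    · show v₁.hi ≤ _
      rw [hsame.hi_eq]; exact hhile
    · show mid < v₁.hi
      rw [hsame.hi_eq]; omega
    · show ∃ x y, a + b - 1 = x + y ∧ v₁.hi - mid ≤ 2 ^ x ∧ 2 ^ e ≤ (mid + 1) * 2 ^ y
      rw [hsame.hi_eq]
      rcases hmid' with h' | h'
      · refine ⟨a, b - 1, by omega, by omega, hb'.trans (le_of_eq ?_)⟩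
        rw [h', show 2 * v'.lo + 1 + 1 = (v'.lo + 1) * 2 by ring, mul_assoc, ← pow_succ']
        congr 2
        omega
      · exact ⟨a - 1, b, by omega, by omega, hb'.trans (Nat.mul_le_mul_right _ (by omega))⟩
    · simp only [Expr.cost]
      have := htm mid (by omega) (c + 4) (by omega)
      show τ + (c + _) ≤ (2 * e - (a + b - 1)) * (600 * (v.r * numSamples v.k v.L (2 * mid + 1)))
      omega
  · have hnp : ¬ Pass A B v.k v.r v.L R v.i mid := fun hp => hok.2 hp h
    refine ⟨_, T₁, a + b - 1, rfl, by omega, fun c hc =>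
      ⟨⟨hbase.n_eq, hbase.k_eq, hbase.s_eq, hbase.r_eq, hbase.L_eq, hbase.i_eq, hbase.g_eq⟩, ?_,
        .inr ⟨by show 0 < mid; omega, hnp⟩, ?_, ?_, ?_, by omega, ?_, hc₂, hbl₁⟩⟩
    · show v₁.lo = 0 ∨ v.i + v₁.lo + v.r ≤ n ∧ Pass A B v.k v.r v.L R v.i v₁.lo
      rw [hsame.lo_eq]; exact hlo
    · show mid ≤ _
      omega
    · show v₁.lo = 0 ∨ v₁.lo < mid
      rw [hsame.lo_eq]; omega
    · show ∃ x y, a + b - 1 = x + y ∧ mid - v₁.lo ≤ 2 ^ x ∧ 2 ^ e ≤ (v₁.lo + 1) * 2 ^ y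
      rw [hsame.lo_eq]
      exact ⟨a - 1, b, by omega, by omega, hb'⟩
    · simp only [Expr.cost]
      have := htm v'.lo le_rfl (c + 4) (by omega)
      show τ + (c + _) ≤
        (2 * e - (a + b - 1)) * (600 * (v.r * numSamples v.k v.L (2 * v₁.lo + 1)))
      rw [hsame.lo_eq]
      omega

/-- The time is charged to the final length `l`, unknown when the search begins. No potential can be
fixed in advance, so the loop is treated by `Wp.while_elapsed`. -/
theorem wp_roundProg (hEA : E.strA = readString A) (hEB : E.strB = readString B)
    {R : ℕ → ℕ} {pos e : ℕ} {v : Vars} {T : ℕ → ℕ}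
    (hs : v.s = σ + 1) (hn : v.n = n) (hr : v.k < v.r * v.r) (hL : 0 < v.L)
    (hne : n < 2 ^ e) (hi : v.i ≤ n) (hrn : v.r ≤ n)
    (hsz : 2 * n + 2 * v.k + 2 * v.r + 5 < 2 ^ E.w) (hg : v.g + 1 < 2 ^ E.w)
    (hm : numSamples v.k v.L n + 1 < 2 ^ E.w)
    (hctr : (v.ctr + 2 * e * (v.r * numSamples v.k v.L n + 1) + 2) * v.s < 2 ^ E.w)
    (hT : Blank T v.s v.ctr) :
    Wp E roundProg (st v T R pos) fun t s' => ∃ v' T' l, s' = st v' T' R pos ∧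
      v'.n = v.n ∧ v'.k = v.k ∧ v'.s = v.s ∧ v'.r = v.r ∧ v'.L = v.L ∧ v'.g = v.g + 1 ∧
      v'.i = v.i + l + 1 + v.r ∧ v'.i ≤ 2 * n + 1 ∧
      v'.ctr ≤ v.ctr + 2 * e * (v.r * numSamples v.k v.L n + 1) ∧ Blank T' v.s v'.ctr ∧
      Round A B v.k v.r v.L R v.i v'.i ∧
      t ≤ 2 * e * (600 * (v.r * numSamples v.k v.L (2 * l + 1))) + 50 := by
  have hw : 1 < 2 ^ E.w := by omega
  unfold roundProg
  refine .seq_assign (a := 0) (eval_lit (by omega)) (set_lo ..) ?_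
  refine .seq_assign (a := n + 1 - (v.i + v.r)) ?_ (set_hi ..) ?_
  · rw [← hn]
    refine eval_sub (eval_add rfl (eval_lit hw) ?_) (eval_add rfl rfl ?_) ?_
    · show v.n + 1 < _
      omega
    · show v.i + v.r < _
      omega
    · show v.n + 1 - (v.i + v.r) < _
      omega
  refine .seq (Wp.while_elapsed (τ := 0) (μ := 2 * e)
    (fun τ μ s' => ∃ v' T', s' = st v' T' R pos ∧ Search A B R e v v' T' τ μ)
    ⟨_, T, rfl, ⟨⟨rfl, rfl, rfl, rfl, rfl, rfl, rfl⟩, .inl rfl, .inl rfl, le_rfl, .inl rfl,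
      ⟨e, e, by omega, ?_, ?_⟩, le_rfl, by omega, Nat.le_add_right _ _, hT⟩⟩ ?_ ?_)
  · show n + 1 - (v.i + v.r) - 0 ≤ 2 ^ e
    omega
  · show 2 ^ e ≤ (0 + 1) * 2 ^ e
    omega
  · rintro τ μ _ ⟨v', T', rfl, hS⟩ hcond
    have hhile := hS.hi_le
    have hlo : v'.lo = 0 ∨ v'.lo < v'.hi := hS.lo_lt
    have hlt : v'.lo + 1 < v'.hi :=
      lt_eval_ne_zero (eval_add rfl (eval_lit hw) (by show v'.lo + 1 < _; omega)) rfl hcond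
    refine .seq_assign (a := v'.lo + v'.lo + 1) (eval_add (eval_add rfl rfl ?_) (eval_lit hw) ?_)
      (set_mid ..) ?_
    · show v'.lo + v'.lo < _
      omega
    · show v'.lo + v'.lo + 1 < _
      omega
    have hev : ∀ mid : ℕ, (Expr.bin .div (.bin .add (.reg 12) (.reg 13)) (.lit 2)).eval E
        (st { v' with mid := mid } T' R pos) = (v'.lo + v'.hi) / 2 := by
      intro mid
      refine eval_div (eval_add rfl rfl ?_) (eval_lit (by omega)) ?_
      · show v'.lo + v'.hi < _
        omega
      · show (v'.lo + v'.hi) / 2 < _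
        omega
    have fin : ∀ mid c₀, c₀ ≤ 50 → (mid = 2 * v'.lo + 1 ∨ mid = (v'.lo + v'.hi) / 2) →
        mid ≤ 2 * v'.lo + 1 → 2 * mid ≤ v'.lo + v'.hi → v'.lo < mid →
        Wp E updateProg (st { v' with mid := mid } T' R pos) fun t s' => ∃ μ' < μ,
          ∃ v' T', s' = st v' T' R pos ∧ Search A B R e v v' T' (τ + (c₀ + t)) μ' := by
      intro mid c₀ hc h0 h1 h2 h3
      refine Wp.mono (wp_updateProg (v' := { v' with mid := mid }) hEA hEB hs hr hL hne
        (by omega) hm hctr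
        ⟨⟨hS.n_eq, hS.k_eq, hS.s_eq, hS.r_eq, hS.L_eq, hS.i_eq, hS.g_eq⟩, hS.lo_spec, hS.hi_spec, hS.hi_le, hS.lo_lt,
          hS.fuel, hS.fuel_le, hS.time, hS.ctr_le, hS.blank⟩ hlt rfl h0 h1 h2 h3) ?_
      rintro t _ ⟨v'', T'', μ', rfl, hμ, hS'⟩
      exact ⟨μ', hμ, v'', T'', rfl, hS' c₀ hc⟩
    refine .seq (.ite (fun h => .assign (hev _) (set_mid ..) ?_) fun h => .skip ?_)
    · have hlt' := lt_eval_ne_zero (hev _) rfl h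
      replace hlt' : (v'.lo + v'.hi) / 2 < v'.lo + v'.lo + 1 := hlt'
      refine Wp.mono (fin _ 26 (by omega) (.inr rfl) (by omega) (by omega) (by omega)) ?_
      rintro t _ ⟨μ', hμ, v'', T'', rfl, hS'⟩
      refine ⟨μ', hμ, v'', T'', rfl, ?_⟩
      simp only [Expr.cost]
      convert hS' using 1
      omega
    · have hge := lt_eval_eq_zero hw (hev _) rfl h
      replace hge : v'.lo + v'.lo + 1 ≤ (v'.lo + v'.hi) / 2 := hge
      refine Wp.mono (fin _ 21 (by omega) (.inl (by omega)) (by omega) (by omega) (by omega)) ?_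
      rintro t _ ⟨μ', hμ, v'', T'', rfl, hS'⟩
      refine ⟨μ', hμ, v'', T'', rfl, ?_⟩
      simp only [Expr.cost]
      convert hS' using 1
      omega
  · rintro τ μ _ ⟨v', T', rfl, hS⟩ hcond t ht
    have hhile := hS.hi_le
    have hlo : v'.lo = 0 ∨ v'.lo < v'.hi := hS.lo_lt
    have hle : v'.hi ≤ v'.lo + 1 :=
      lt_eval_eq_zero hw (eval_add rfl (eval_lit hw) (by show v'.lo + 1 < _; omega)) rfl hcond
    have hb := hS.toBase
    refine .seq_assign (a := v.i + v'.lo + 1 + v.r) ?_ (set_i ..) ?_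
    · rw [← hb.i_eq, ← hb.r_eq]
      have := hb.i_eq
      have := hb.r_eq
      refine eval_add (eval_add (eval_add rfl rfl ?_) (eval_lit hw) ?_) rfl ?_
      · show v'.i + v'.lo < _
        omega
      · show v'.i + v'.lo + 1 < _
        omega
      · show v'.i + v'.lo + 1 + v'.r < _
        omega
    refine .assign (a := v.g + 1) ?_ (set_g ..) ?_
    · rw [← hb.g_eq] at hg ⊢
      exact eval_add rfl (eval_lit hw) hg
    refine ⟨_, T', v'.lo, rfl, hb.n_eq, hb.k_eq, hb.s_eq, hb.r_eq, hb.L_eq, rfl, rfl, ?_, ?_, hS.blank,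
      ⟨v'.lo, rfl, hS.lo_spec, ?_⟩, ?_⟩
    · show v.i + v'.lo + 1 + v.r ≤ _
      omega
    · exact hS.ctr_le.trans (Nat.add_le_add_left (Nat.mul_le_mul_right _ (by omega)) _)
    · intro hin
      replace hin : v.i + v'.lo + 1 + v.r ≤ n := hin
      -- The initial upper end `n + 1 - (i + r)` is never tested; a search that closes against it
      -- leaves the string, contrary to `hin`.
      rcases hS.hi_spec with h | ⟨h, h'⟩
      · omega
      · rwa [show v'.hi = v'.lo + 1 by omega] at h'
    · have h1 := hS.time
      have h2 : (2 * e - μ) * (600 * (v.r * numSamples v.k v.L (2 * v'.lo + 1))) ≤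
          2 * e * (600 * (v.r * numSamples v.k v.L (2 * v'.lo + 1))) :=
        Nat.mul_le_mul_right _ (by omega)
      simp only [Expr.cost] at ht ⊢
      omega

end GapED

/-! ### The whole program: parameters, samples and the greedy loop -/

namespace GapED

open WordRAM

section Program

open Expr Prog

/-- Compute `r = ⌊√k⌋ + 1`. -/
def sqrtProg : Prog :=
  seq (assign 3 (lit 1)) <|
  .while (bin .lt (bin .mul (reg 3) (reg 3)) (bin .add (reg 1) (lit 1))) <|
    assign 3 (bin .add (reg 3) (lit 1))

/-- Compute `L = 16 (⌊log₂ n⌋ + 1)`. -/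
def logProg : Prog :=
  seq (assign 5 (lit 1)) <|
  .while (bin .lt (reg 5) (bin .add (reg 0) (lit 1))) <|
    seq (assign 5 (bin .add (reg 5) (reg 5))) <|
    assign 4 (bin .add (reg 4) (lit 16))

/-- Store the random words. -/
def sampleProg : Prog :=
  seq (assign 6 (bin .mul (bin .add (bin .div (reg 0) (reg 1)) (lit 1)) (reg 4))) <|
  .while (bin .lt (reg 7) (reg 6)) <|
    seq (rand 8) <| seq (store 1 (reg 7) (reg 8)) <|
    assign 7 (bin .add (reg 7) (lit 1))

/-- The greedy rounds. -/
def greedyProg : Prog :=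
  .while (bin .mul (bin .lt (reg 10) (bin .add (reg 0) (lit 1)))
    (bin .lt (reg 11) (bin .add (reg 1) (lit 1)))) roundProg

/-- The algorithm for the case `40 k ^ 2 < n`. -/
def mainProg : Prog :=
  seq (assign 2 (bin .add (reg 2) (lit 1))) <|
  seq sqrtProg <| seq logProg <| seq sampleProg <| seq greedyProg <|
  assign 0 (bin .lt (reg 0) (reg 10))

/-- The algorithm. -/
def gapProg : Prog :=
  ite (bin .lt (bin .mul (bin .mul (lit 40) (reg 1)) (reg 1)) (reg 0)) mainProg
    (assign 0 (lit 1))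

end Program

variable {E : Env}

theorem wp_sqrtProg {v : Vars} {T R : ℕ → ℕ} {pos : ℕ}
    (hk : (v.k + 2) * (v.k + 2) < 2 ^ E.w) :
    Wp E sqrtProg (st v T R pos) fun t s' =>
      s' = st { v with r := Nat.sqrt v.k + 1 } T R pos ∧ t ≤ 20 * (Nat.sqrt v.k + 1) := by
  have hk' : (v.k + 2) * (v.k + 2) = v.k * v.k + 4 * v.k + 4 := by ring
  have hw : 1 < 2 ^ E.w := by omega
  have hsq := Nat.sqrt_le_self v.k
  have hev : ∀ r : ℕ, (Expr.bin .add (.reg 1) (.lit 1)).eval E (st { v with r := r } T R pos)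
      = v.k + 1 := fun r => eval_add rfl (eval_lit hw) (by show v.k + 1 < _; omega)
  have hev' : ∀ r : ℕ, r ≤ v.k + 1 → (Expr.bin .mul (.reg 3) (.reg 3)).eval E
      (st { v with r := r } T R pos) = r * r := fun r hr => eval_mul rfl rfl
        (lt_of_le_of_lt (Nat.mul_le_mul (by show r ≤ v.k + 2; omega)
          (by show r ≤ v.k + 2; omega)) hk)
  unfold sqrtProg
  refine .seq_assign (a := 1) (eval_lit hw) (set_r ..) ?_
  refine Wp.while (φ := 12 * Nat.sqrt v.k) (fun φ s' => ∃ r,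
      s' = st { v with r := r } T R pos ∧ 0 < r ∧ r ≤ Nat.sqrt v.k + 1 ∧
      φ = 12 * (Nat.sqrt v.k + 1 - r)) ⟨1, rfl, by omega, by omega, by omega⟩ ?_ ?_
  · rintro φ _ ⟨r, rfl, hr, hr', rfl⟩ hcond
    have hlt := lt_eval_ne_zero (hev' r (by omega)) (hev r) hcond
    have hle : r ≤ Nat.sqrt v.k := Nat.le_sqrt.2 (by omega)
    refine .assign (a := r + 1) (eval_add rfl (eval_lit hw) (by show r + 1 < _; omega))
      (set_r ..) ⟨_, ⟨r + 1, rfl, by omega, by omega, rfl⟩, ?_⟩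
    simp only [Expr.cost]
    omega
  · rintro φ _ t ⟨r, rfl, hr, hr', rfl⟩ hcond ht
    have hge := lt_eval_eq_zero hw (hev' r (by omega)) (hev r) hcond
    have : Nat.sqrt v.k < r := Nat.sqrt_lt.2 (by omega)
    obtain rfl : r = Nat.sqrt v.k + 1 := by omega
    refine ⟨rfl, ?_⟩
    simp only [Expr.cost] at ht ⊢
    omega

theorem wp_logProg {v : Vars} {T R : ℕ → ℕ} {pos : ℕ} (hL : v.L = 0) (hn : v.n ≠ 0)
    (hsz : 20 * v.n + 20 < 2 ^ E.w) :
    Wp E logProg (st v T R pos) fun t s' => ∃ p,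
      s' = st { v with L := 16 * (Nat.log 2 v.n + 1), p := p } T R pos ∧
      t ≤ 30 * (Nat.log 2 v.n + 1) := by
  have hw : 1 < 2 ^ E.w := by omega
  have hln : Nat.log 2 v.n < v.n := Nat.log_lt_self 2 hn
  have hev : ∀ p L : ℕ, (Expr.bin .add (.reg 0) (.lit 1)).eval E
      (st { v with p := p, L := L } T R pos) = v.n + 1 :=
    fun p L => eval_add rfl (eval_lit hw) (by show v.n + 1 < _; omega)
  unfold logProg
  refine .seq_assign (a := 1) (eval_lit hw) (set_p ..) ?_
  refine Wp.while (φ := 20 * (Nat.log 2 v.n + 1)) (fun φ s' => ∃ u,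
      s' = st { v with p := 2 ^ u, L := 16 * u } T R pos ∧ u ≤ Nat.log 2 v.n + 1 ∧
      φ = 20 * (Nat.log 2 v.n + 1 - u)) ⟨0, by cases v; subst hL; rfl, by omega, by omega⟩
      ?_ ?_
  · rintro φ _ ⟨u, rfl, hu, rfl⟩ hcond
    have hlt : 2 ^ u < v.n + 1 := lt_eval_ne_zero rfl (hev _ _) hcond
    have hle : u ≤ Nat.log 2 v.n := (Nat.le_log_iff_pow_le (by omega) hn).2 (by omega)
    refine .seq_assign (a := 2 ^ u + 2 ^ u) (eval_add rfl rfl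
      (by show 2 ^ u + 2 ^ u < _; omega)) (set_p ..) (.assign (a := 16 * u + 16)
      (eval_add rfl (eval_lit (by omega)) (by show 16 * u + 16 < _; omega)) (set_L ..)
      ⟨_, ⟨u + 1, ?_, by omega, rfl⟩, ?_⟩)
    · rw [pow_succ, mul_two, Nat.mul_add]
    · simp only [Expr.cost]
      omega
  · rintro φ _ t ⟨u, rfl, hu, rfl⟩ hcond ht
    have hge : v.n + 1 ≤ 2 ^ u := lt_eval_eq_zero hw rfl (hev _ _) hcond
    have : Nat.log 2 v.n < u := Nat.log_lt_of_lt_pow hn (by omega)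
    obtain rfl : u = Nat.log 2 v.n + 1 := by omega
    refine ⟨_, rfl, ?_⟩
    simp only [Expr.cost] at ht ⊢
    omega

/-- The first `M` words of a tape. -/
def tapePrefix (τ : ℕ → ℕ) (M a : ℕ) : ℕ := if a < M then τ a else 0

theorem tapePrefix_succ (τ : ℕ → ℕ) (M : ℕ) :
    Function.update (tapePrefix τ M) M (τ M) = tapePrefix τ (M + 1) := by
  funext a
  rcases eq_or_ne a M with rfl | h
  · rw [Function.update_self, tapePrefix, if_pos (by omega)]
  · rw [Function.update_of_ne h, tapePrefix, tapePrefix]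
    exact if_congr (by omega) rfl rfl

theorem Wp.rand {x : ℕ} {s : State} {Q : ℕ → State → Prop}
    (h : Q 1 { s.setReg x (E.tape s.pos) with pos := s.pos + 1 }) : Wp E (.rand x) s Q :=
  ⟨_, _, .rand s x, h⟩

/-- All random words are drawn here, enough for the longest window; every test reuses an initial
segment of them. -/
theorem wp_sampleProg {v : Vars} {T : ℕ → ℕ} (hj : v.j = 0) (hL : 0 < v.L)
    (hm : numSamples v.k v.L v.n + 1 < 2 ^ E.w) :
    Wp E sampleProg (st v T (fun _ => 0) 0) fun t s' => ∃ M j x pos,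
      s' = st { v with M := M, j := j, x := x } T
        (tapePrefix E.tape (numSamples v.k v.L v.n)) pos ∧
      t ≤ 20 * numSamples v.k v.L v.n + 20 := by
  have hw : 1 < 2 ^ E.w := by omega
  set M := numSamples v.k v.L v.n with hM
  have hm1 : v.n / v.k + 1 ≤ M := Nat.le_mul_of_pos_right _ hL
  unfold sampleProg
  refine .seq_assign (a := M) (eval_mul (eval_add (eval_div rfl rfl ?_) (eval_lit hw) ?_) rfl ?_)
    (set_M ..) ?_
  · exact (Nat.lt_of_succ_le hm1).trans (by omega)
  · exact lt_of_le_of_lt hm1 (by omega)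
  · show M < _
    omega
  refine Wp.while (φ := 15 * M) (fun φ s' => ∃ j x,
      s' = st { v with M := M, j := j, x := x } T (tapePrefix E.tape j) j ∧ j ≤ M ∧
      φ = 15 * (M - j)) ⟨0, v.x, ?_, by omega, by omega⟩ ?_ ?_
  · rw [← hj]
    congr 1
    funext a
    simp [tapePrefix, hj]
  · rintro φ _ ⟨j, x, rfl, hjM, rfl⟩ hcond
    have hlt : j < M := lt_eval_ne_zero rfl rfl hcond
    refine .seq (.rand ?_)
    have hst : ({ (st { v with M := M, j := j, x := x } T (tapePrefix E.tape j) j).setReg 8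
        (E.tape j) with pos := j + 1 } : State) =
        st { v with M := M, j := j, x := E.tape j } T (tapePrefix E.tape j) (j + 1) := by
      rw [set_x]; rfl
    refine (congrArg (fun s => Wp E _ s _) hst).mpr ?_
    refine .seq (.store (idx := j) (a := E.tape j) rfl rfl (set_rand ..) ?_)
    rw [tapePrefix_succ]
    refine .assign (a := j + 1) (eval_add rfl (eval_lit hw) (by show j + 1 < _; omega)) (set_j ..)
      ⟨_, ⟨j + 1, E.tape j, rfl, by omega, rfl⟩, ?_⟩
    simp only [Expr.cost]
    omega
  · rintro φ _ t ⟨j, x, rfl, hjM, rfl⟩ hcond ht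
    have hge : M ≤ j := lt_eval_eq_zero hw rfl rfl hcond
    obtain rfl : j = M := by omega
    refine ⟨_, _, x, _, rfl, ?_⟩
    simp only [Expr.cost] at ht ⊢
    omega

variable {n σ : ℕ} {A B : Fin n → Fin σ}

/-- Amortised analysis: the potential is `D` times twice the remaining positions over `k` plus the
remaining rounds. The count starts from `2 * n + 2` because the last jump may reach `2 * n + 1`. -/
theorem wp_greedyProg (hEA : E.strA = readString A) (hEB : E.strB = readString B)
    {R : ℕ → ℕ} {pos e : ℕ} {v : Vars} {T : ℕ → ℕ}
    (hs : v.s = σ + 1) (hn : v.n = n) (hk : 0 < v.k) (hr : v.k < v.r * v.r) (hL : 0 < v.L)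
    (hne : n < 2 ^ e) (hi : v.i = 0) (hg : v.g = 0) (hc : v.ctr = 0) (hrn : v.r ≤ n)
    (hsz : 2 * n + 2 * v.k + 2 * v.r + 5 < 2 ^ E.w)
    (hm : numSamples v.k v.L n + 1 < 2 ^ E.w)
    (hctr : ((v.k + 1) * (2 * e * (v.r * numSamples v.k v.L n + 1)) + 2) * v.s < 2 ^ E.w)
    (hT : Blank T v.s 0) :
    Wp E greedyProg (st v T R pos) fun t s' => ∃ v' T', s' = st v' T' R pos ∧ v'.n = n ∧
      t ≤ 1300 * (e * v.r * v.L) * (2 * (2 * n + 2) / v.k + (v.k + 1)) + 20 ∧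
      Rounds A B v.k v.r v.L R v'.g v'.i ∧
      v'.g ≤ v.k + 1 ∧ (n < v'.i ∨ v'.g = v.k + 1) := by
  have hw : 1 < 2 ^ E.w := by omega
  have hr0 : 0 < v.r := by
    rcases Nat.eq_zero_or_pos v.r with h | h
    · simp [h] at hr
    · exact h
  have he0 : 0 < e := by
    rcases Nat.eq_zero_or_pos e with rfl | h
    · simp at hne; omega
    · exact h
  set D := 1300 * (e * v.r * v.L) with hD
  have hD1 : 1 ≤ e * v.r * v.L := Nat.mul_pos (Nat.mul_pos he0 hr0) hL
  set X := 2 * e * (v.r * numSamples v.k v.L n + 1) with hX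
  have hcond₁ : ∀ v' : Vars, v'.n = v.n → ∀ T' : ℕ → ℕ,
      (Expr.bin .lt (.reg 10) (.bin .add (.reg 0) (.lit 1))).eval E (st v' T' R pos) =
        if v'.i < n + 1 then 1 else 0 := by
    intro v' h1 T'
    refine eval_lt hw rfl ?_
    rw [← hn, ← h1]
    exact eval_add rfl (eval_lit hw) (by show v'.n + 1 < _; omega)
  have hcond₂ : ∀ v' : Vars, v'.k = v.k → ∀ T' : ℕ → ℕ,
      (Expr.bin .lt (.reg 11) (.bin .add (.reg 1) (.lit 1))).eval E (st v' T' R pos) =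
        if v'.g < v.k + 1 then 1 else 0 := by
    intro v' h1 T'
    refine eval_lt hw rfl ?_
    rw [← h1]
    exact eval_add rfl (eval_lit hw) (by show v'.k + 1 < _; omega)
  have hcond : ∀ v' : Vars, v'.n = v.n → v'.k = v.k → ∀ T' : ℕ → ℕ,
      (Expr.bin .mul (.bin .lt (.reg 10) (.bin .add (.reg 0) (.lit 1)))
        (.bin .lt (.reg 11) (.bin .add (.reg 1) (.lit 1)))).eval E (st v' T' R pos) =
        (if v'.i < n + 1 then 1 else 0) * (if v'.g < v.k + 1 then 1 else 0) := by
    intro v' h1 h2 T'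
    refine eval_mul (hcond₁ v' h1 T') (hcond₂ v' h2 T') ?_
    split_ifs <;> omega
  unfold greedyProg
  refine Wp.while (φ := D * (2 * (2 * n + 2) / v.k + (v.k + 1))) (fun φ s' => ∃ v' T',
    s' = st v' T' R pos ∧ v'.n = v.n ∧ v'.k = v.k ∧ v'.s = v.s ∧ v'.r = v.r ∧ v'.L = v.L ∧
      v'.g ≤ v.k + 1 ∧ v'.i ≤ 2 * n + 1 ∧ v'.ctr ≤ v'.g * X ∧ Blank T' v.s v'.ctr ∧
      Rounds A B v.k v.r v.L R v'.g v'.i ∧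
      φ = D * (2 * (2 * n + 2 - v'.i) / v.k + (v.k + 1 - v'.g)))
    ⟨v, T, rfl, rfl, rfl, rfl, rfl, rfl, by omega, by omega, by omega, by rw [hc]; exact hT,
      by rw [hg, hi]; exact .zero, by rw [hg, hi]; rfl⟩ ?_ ?_
  · rintro φ _ ⟨v', T', rfl, h1, h2, h3, h4, h5, hgk, hin, hcX, hbl, hrd, rfl⟩ hc'
    rw [hcond v' h1 h2] at hc'
    have hi' : v'.i < n + 1 := by
      by_contra hh
      simp [hh] at hc'
    have hg' : v'.g < v.k + 1 := by
      by_contra hh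
      simp [hh] at hc'
    have hX1 : (v'.g + 1) * X ≤ (v.k + 1) * X := Nat.mul_le_mul_right _ hg'
    rw [Nat.add_mul, Nat.one_mul] at hX1
    refine Wp.mono (wp_roundProg (A := A) (B := B) (e := e) hEA hEB (h3.trans hs) (h1.trans hn)
      (by rw [h2, h4]; exact hr) (by rw [h5]; exact hL) hne (by omega) (by omega) (by omega)
      (by omega) (by rw [h2, h5]; exact hm) ?_ (by rw [h3]; exact hbl)) ?_
    · rw [h2, h3, h4, h5]
      exact lt_of_le_of_lt (Nat.mul_le_mul_right _ (by omega)) hctr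
    rintro t _ ⟨v'', T'', l, rfl, g1, g2, g3, g4, g5, g6, g7, g8, g9, g10, g11, g12⟩
    rw [h2, h4, h5] at g9 g11 g12
    refine ⟨_, ⟨v'', T'', rfl, g1.trans h1, g2.trans h2, g3.trans h3, g4.trans h4, g5.trans h5,
      by omega, g8, ?_, by rw [← h3]; exact g10, ?_, rfl⟩, ?_⟩
    · rw [g6, Nat.add_mul, Nat.one_mul]
      omega
    · rw [g6]
      exact .succ hrd (by omega) g11
    · have hd : (2 * l + 1) / v.k + 2 * (2 * n + 2 - v''.i) / v.k ≤
          2 * (2 * n + 2 - v'.i) / v.k :=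
        Nat.div_add_div_le_add_div.trans (Nat.div_le_div_right (by omega))
      have hgg : v.k + 1 - v'.g = 1 + (v.k + 1 - v''.g) := by omega
      have e1 : 2 * e * (600 * (v.r * numSamples v.k v.L (2 * l + 1))) =
          1200 * (e * v.r * v.L) * ((2 * l + 1) / v.k + 1) := by
        unfold numSamples; ring
      -- The surplus of 1300 over 1200 covers the loop test and the constant 50 of a round.
      have e2 : D * ((2 * l + 1) / v.k + 1) = 1200 * (e * v.r * v.L) * ((2 * l + 1) / v.k + 1) +
          100 * (e * v.r * v.L) * ((2 * l + 1) / v.k + 1) := by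
        rw [hD]; ring
      have e3 : 100 ≤ 100 * (e * v.r * v.L) * ((2 * l + 1) / v.k + 1) :=
        le_trans (by omega : 100 ≤ 100 * (e * v.r * v.L)) (Nat.le_mul_of_pos_right _ (Nat.succ_pos _))
      have e4 : D * ((2 * l + 1) / v.k + 1) +
          D * (2 * (2 * n + 2 - v''.i) / v.k + (v.k + 1 - v''.g)) ≤
          D * (2 * (2 * n + 2 - v'.i) / v.k + (v.k + 1 - v'.g)) := by
        rw [← Nat.mul_add]
        exact Nat.mul_le_mul_left _ (by omega)
      simp only [Expr.cost]
      omega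
  · rintro φ _ t ⟨v', T', rfl, h1, h2, h3, h4, h5, hgk, hin, hcX, hbl, hrd, -⟩ hc' ht
    rw [hcond v' h1 h2] at hc'
    refine ⟨v', T', rfl, h1.trans hn, ?_, hrd, hgk, ?_⟩
    · simp only [Expr.cost] at ht
      omega
    · by_contra! hh
      rw [if_pos (by omega), if_pos (by omega)] at hc'
      omega

theorem init_eq_st {w n k σ : ℕ} (hn : n < 2 ^ w) (hk : k < 2 ^ w) (hσ : σ < 2 ^ w) :
    init w n k σ = st { n := n, k := k, s := σ } (fun _ => 0) (fun _ => 0) 0 := by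
  have hreg : ∀ x, (init w n k σ).reg x =
      (st { n := n, k := k, s := σ } (fun _ => 0) (fun _ => 0) 0).reg x := by
    rintro (_ | _ | _ | x)
    · exact Nat.mod_eq_of_lt hn
    · exact Nat.mod_eq_of_lt hk
    · exact Nat.mod_eq_of_lt hσ
    -- There are 22 registers, and three of them hold inputs.
    · show 0 = (List.replicate 19 0).getD x 0
      rw [List.getD_eq_getElem?_getD, List.getElem?_replicate]
      split <;> rfl
  have harr : ∀ a, (init w n k σ).arr a =
      (st { n := n, k := k, s := σ } (fun _ => 0) (fun _ => 0) 0).arr a := by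
    intro a
    simp only [init, st]
    split_ifs <;> rfl
  exact congrArg₂ (fun f g => State.mk f g 0) (funext hreg) (funext harr)

/-- Bound on the running time. -/
def timeBound (n k : ℕ) : ℕ :=
  2000 * ((Nat.log 2 n + 1) * (Nat.sqrt k + 1) * (16 * (Nat.log 2 n + 1))) *
    (2 * (2 * n + 2) / k + (k + 1))

theorem time_le_timeBound {n k t₁ t₂ t₃ t₄ : ℕ} (hk : 0 < k) (ht₁ : t₁ ≤ 20 * (Nat.sqrt k + 1))
    (ht₂ : t₂ ≤ 30 * (Nat.log 2 n + 1))
    (ht₃ : t₃ ≤ 20 * numSamples k (16 * (Nat.log 2 n + 1)) n + 20)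
    (ht₄ : t₄ ≤ 1300 * ((Nat.log 2 n + 1) * (Nat.sqrt k + 1) *
      (16 * (Nat.log 2 n + 1))) * (2 * (2 * n + 2) / k + (k + 1)) + 20) :
    50 + t₁ + t₂ + t₃ + t₄ ≤ timeBound n k := by
  unfold timeBound
  set e := Nat.log 2 n + 1 with he
  set r := Nat.sqrt k + 1 with hr
  have hq1 : 2 ≤ 2 * (2 * n + 2) / k + (k + 1) := le_add_left (by omega)
  have hnq : n / k + 1 ≤ 2 * (2 * n + 2) / k + (k + 1) :=
    Nat.add_le_add (Nat.div_le_div_right (by omega)) (by omega)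
  generalize 2 * (2 * n + 2) / k + (k + 1) = q at *
  have he1 : 1 ≤ e := by omega
  have hr1 : 1 ≤ r := by omega
  have hLe : 16 * e ≤ e * r * (16 * e) := Nat.le_mul_of_pos_left _ (Nat.mul_pos he1 hr1)
  have hre : r ≤ e * r * (16 * e) :=
    (Nat.le_mul_of_pos_left _ he1).trans (Nat.le_mul_of_pos_right _ (by omega))
  have hns : numSamples k (16 * e) n ≤ e * r * (16 * e) * q := by
    unfold numSamples
    rw [mul_comm]
    exact Nat.mul_le_mul hLe hnq
  have hGq : e * r * (16 * e) * 2 ≤ e * r * (16 * e) * q := Nat.mul_le_mul_left _ hq1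
  rw [mul_assoc] at ht₄ ⊢
  omega

/-- The run is returned together with its `Rounds`, so that the remaining argument concerns strings
and samples and no longer the machine. -/
theorem wp_gapProg (hEA : E.strA = readString A) (hEB : E.strB = readString B) {k : ℕ}
    (hk : 0 < k) (hkn : 40 * k ^ 2 < n) (hsz : 20 * n + 20 < 2 ^ E.w)
    (hm : numSamples k (16 * (Nat.log 2 n + 1)) n + 1 < 2 ^ E.w)
    (hctr : ((k + 1) * (2 * (Nat.log 2 n + 1) *
      ((Nat.sqrt k + 1) * numSamples k (16 * (Nat.log 2 n + 1)) n + 1)) + 2) * (σ + 1)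
        < 2 ^ E.w) :
    Wp E gapProg (init E.w n k σ) fun t s' => t ≤ timeBound n k ∧ ∃ g i,
      Rounds A B k (Nat.sqrt k + 1) (16 * (Nat.log 2 n + 1))
        (tapePrefix E.tape (numSamples k (16 * (Nat.log 2 n + 1)) n)) g i ∧
      g ≤ k + 1 ∧ (n < i ∧ s'.reg 0 = 1 ∨ i ≤ n ∧ g = k + 1 ∧ s'.reg 0 = 0) := by
  have hw : 1 < 2 ^ E.w := by omega
  have hkk : k ≤ k * k := Nat.le_mul_of_pos_left _ hk
  rw [pow_two] at hkn
  have hσ : σ + 1 < 2 ^ E.w :=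
    lt_of_le_of_lt (Nat.le_mul_of_pos_left _ (by omega)) hctr
  have hsq := Nat.sqrt_le_self k
  have hn0 : n ≠ 0 := by omega
  rw [init_eq_st (by omega) (by omega) (by omega)]
  have hprod : (Expr.bin .lt (.bin .mul (.bin .mul (.lit 40) (.reg 1)) (.reg 1)) (.reg 0)).eval E
      (st { n := n, k := k, s := σ } (fun _ => 0) (fun _ => 0) 0) = 1 := by
    rw [eval_lt (a := 40 * k * k) (b := n) hw (eval_mul (eval_mul (eval_lit (by omega)) rfl ?_)
      rfl ?_) rfl]
    · rw [mul_assoc, if_pos hkn]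
    · show 40 * k < _
      omega
    · show 40 * k * k < _
      rw [mul_assoc]
      omega
  refine .ite (fun _ => ?_) (fun h => by rw [hprod] at h; omega)
  unfold mainProg
  refine .seq_assign (a := σ + 1) (eval_add rfl (eval_lit hw) hσ) (set_s ..) ?_
  refine .seq (Wp.mono (wp_sqrtProg ?_) ?_)
  · show (k + 2) * (k + 2) < _
    have : (k + 2) * (k + 2) = k * k + 4 * k + 4 := by ring
    omega
  rintro t₁ _ ⟨rfl, ht₁⟩
  replace ht₁ : t₁ ≤ 20 * (Nat.sqrt k + 1) := ht₁
  refine .seq (Wp.mono (wp_logProg rfl hn0 hsz) ?_)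
  rintro t₂ _ ⟨p, rfl, ht₂⟩
  replace ht₂ : t₂ ≤ 30 * (Nat.log 2 n + 1) := ht₂
  refine .seq (Wp.mono (wp_sampleProg rfl (by show 0 < 16 * (Nat.log 2 n + 1); omega) hm) ?_)
  rintro t₃ _ ⟨M, j, x, pos, rfl, ht₃⟩
  replace ht₃ : t₃ ≤ 20 * numSamples k (16 * (Nat.log 2 n + 1)) n + 20 := ht₃
  refine .seq (Wp.mono (wp_greedyProg (A := A) (B := B) (e := Nat.log 2 n + 1) hEA hEB rfl rfl hk
    (Nat.lt_succ_sqrt k) (by show 0 < 16 * (Nat.log 2 n + 1); omega)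
    (Nat.lt_pow_succ_log_self (by omega) n) rfl rfl rfl
    (by show Nat.sqrt k + 1 ≤ n; omega) ?_ hm hctr ⟨fun _ _ => rfl, fun _ _ => rfl⟩) ?_)
  · show 2 * n + 2 * k + 2 * (Nat.sqrt k + 1) + 5 < _
    omega
  rintro t₄ _ ⟨v', T', rfl, hn', ht₄, hrd, hgk, hor⟩
  replace hgk : v'.g ≤ k + 1 := hgk
  refine .assign (a := if n < v'.i then 1 else 0) (eval_lt hw hn' rfl) (set_n ..) ⟨?_, v'.g, v'.i,
    hrd, hgk, ?_⟩
  · replace ht₄ : t₄ ≤ 1300 * ((Nat.log 2 n + 1) * (Nat.sqrt k + 1) *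
      (16 * (Nat.log 2 n + 1))) * (2 * (2 * n + 2) / k + (k + 1)) + 20 := ht₄
    have := time_le_timeBound (n := n) hk ht₁ ht₂ ht₃ ht₄
    simp only [Expr.cost]
    omega
  · by_cases h : n < v'.i
    · exact .inl ⟨h, if_pos h⟩
    · exact .inr ⟨Nat.le_of_not_lt h, hor.resolve_left h, if_neg h⟩

theorem wp_gapProg_of_le {k : ℕ} (hsz : 40 * k ^ 2 + 40 < 2 ^ E.w) (hn : n < 2 ^ E.w)
    (hσ : σ < 2 ^ E.w) (hk : 0 < k) (hkn : n ≤ 40 * k ^ 2) :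
    Wp E gapProg (init E.w n k σ) fun t s' => t ≤ 10 ∧ s'.reg 0 = 1 := by
  have hkk : k ≤ k * k := Nat.le_mul_of_pos_left _ hk
  rw [pow_two] at hkn hsz
  have hw : 1 < 2 ^ E.w := by omega
  rw [init_eq_st (by omega) (by omega) (by omega)]
  have hprod : (Expr.bin .lt (.bin .mul (.bin .mul (.lit 40) (.reg 1)) (.reg 1)) (.reg 0)).eval E
      (st { n := n, k := k, s := σ } (fun _ => 0) (fun _ => 0) 0) = 0 := by
    rw [eval_lt (a := 40 * k * k) (b := n) hw (eval_mul (eval_mul (eval_lit (by omega)) rfl ?_)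
      rfl ?_) rfl]
    · rw [mul_assoc, if_neg (by omega)]
    · show 40 * k < _
      omega
    · show 40 * k * k < _
      rw [mul_assoc]
      omega
  refine .ite (fun h => absurd hprod h) fun _ =>
    .assign (a := 1) (eval_lit hw) (set_n ..) ⟨?_, rfl⟩
  simp [Expr.cost]

end GapED

namespace GapED

open WordRAM Finset

/-! ### Random tapes -/

/-- The set is a box, so independence of the words amounts to a product of cardinalities. -/
theorem card_avoid {T W m : ℕ} (hm : m ≤ T) (H : Finset (Fin W)) :
    #{ω : Fin T → Fin W | ∀ j : Fin T, (j : ℕ) < m → ω j ∉ H} = (W - #H) ^ m * W ^ (T - m) := by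
  have h1 : ({ω : Fin T → Fin W | ∀ j : Fin T, (j : ℕ) < m → ω j ∉ H} : Finset _) =
      Fintype.piFinset fun j : Fin T => if (j : ℕ) < m then Hᶜ else univ := by
    ext ω
    simp only [mem_filter, mem_univ, true_and, Fintype.mem_piFinset]
    refine forall_congr' fun j => ?_
    split_ifs with h <;> simp [h]
  have h2 : #{j : Fin T | (j : ℕ) < m} = m := by
    have : ({j : Fin T | (j : ℕ) < m} : Finset _).map Fin.valEmbedding = range m := by
      ext x
      simp only [mem_map, mem_filter, mem_univ, true_and, Fin.valEmbedding_apply, mem_range]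
      constructor
      · rintro ⟨j, hj, rfl⟩; exact hj
      · intro hx; exact ⟨⟨x, by omega⟩, hx, rfl⟩
    rw [← card_map Fin.valEmbedding, this, card_range]
  have h3 : #{j : Fin T | ¬ (j : ℕ) < m} = T - m := by
    have := card_filter_add_card_filter_not (s := (univ : Finset (Fin T)))
      (fun j : Fin T => (j : ℕ) < m)
    rw [h2, card_univ, Fintype.card_fin] at this
    omega
  rw [h1, Fintype.card_piFinset]
  simp only [apply_ite Finset.card, card_compl, Fintype.card_fin, card_univ]
  rw [prod_ite, prod_const, prod_const, h2, h3]

/-- Each residue `x < l` has the representatives `x + l * q` with `q < W / l`. The reduced words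
need not be uniform, but only a lower bound is needed. -/
theorem card_mod_mem_ge {W l : ℕ} {S : Finset ℕ} (hS : S ⊆ range l) :
    #S * (W / l) ≤ #{u : Fin W | (u : ℕ) % l ∈ S} := by
  rcases Nat.eq_zero_or_pos W with rfl | hW
  · simp
  rw [← card_range (W / l), ← card_product]
  have hlt : ∀ p ∈ S ×ˢ range (W / l), p.1 + l * p.2 < W := by
    rintro ⟨x, q⟩ hp
    simp only [mem_product, mem_range] at hp
    have hx := mem_range.1 (hS hp.1)
    calc x + l * q < l + l * q := by omega
      _ = l * (q + 1) := by ring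
      _ ≤ l * (W / l) := Nat.mul_le_mul_left _ hp.2
      _ ≤ W := Nat.mul_div_le W l
  refine card_le_card_of_injOn
    (fun p => if h : p.1 + l * p.2 < W then ⟨p.1 + l * p.2, h⟩ else ⟨0, hW⟩) ?_ ?_
  · intro p hp
    have hp' := mem_product.1 hp
    have hx := mem_range.1 (hS hp'.1)
    simp only [dif_pos (hlt p hp)]
    simp [Nat.add_mul_mod_self_left, Nat.mod_eq_of_lt hx, hp'.1]
  · intro p hp p' hp' heq
    have hx := mem_range.1 (hS (mem_product.1 hp).1)
    have hx' := mem_range.1 (hS (mem_product.1 hp').1)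
    simp only [dif_pos (hlt p hp), dif_pos (hlt p' hp'), Fin.mk.injEq] at heq
    have e1 := congrArg (· % l) heq
    have e2 := congrArg (· / l) heq
    simp only [Nat.add_mul_mod_self_left, Nat.mod_eq_of_lt hx, Nat.mod_eq_of_lt hx'] at e1
    simp only [Nat.add_mul_div_left _ _ (by omega : 0 < l), Nat.div_eq_of_lt hx,
      Nat.div_eq_of_lt hx', zero_add] at e2
    exact Prod.ext e1 e2

/-- Few tapes miss a set of more than `k` residues modulo `l` with all their samples. -/
theorem card_miss_le {T W k l e : ℕ} {S : Finset ℕ} (hk : 0 < k) (hS : S ⊆ range l)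
    (hkS : k < #S) (hlW : l ≤ W) (hm : numSamples k (16 * e) l ≤ T) :
    (#{ω : Fin T → Fin W | ∀ j : Fin T, (j : ℕ) < numSamples k (16 * e) l →
      (ω j : ℕ) % l ∉ S} : ℝ) ≤ (1 / 2 ^ e) ^ 8 * (W : ℝ) ^ T := by
  set m := numSamples k (16 * e) l with hmdef
  set H : Finset (Fin W) := {u : Fin W | (u : ℕ) % l ∈ S} with hH
  have hl : k < l := hkS.trans_le (by simpa using card_le_card hS)
  have hW : 0 < W := by omega
  have hWr : (0 : ℝ) < W := by exact_mod_cast hW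
  have hlr : (0 : ℝ) < l := by exact_mod_cast (by omega : 0 < l)
  have hkr : (0 : ℝ) < k := by exact_mod_cast hk
  have hset : (univ.filter fun ω : Fin T → Fin W => ∀ j : Fin T, (j : ℕ) < m →
      (ω j : ℕ) % l ∉ S) = univ.filter fun ω => ∀ j : Fin T, (j : ℕ) < m → ω j ∉ H := by
    ext ω; simp [hH]
  rw [hset, card_avoid hm]
  have hHW : #H ≤ W := by simpa using card_le_univ H
  have hHge : k * (W / l) ≤ #H :=
    (Nat.mul_le_mul_right _ hkS.le).trans (card_mod_mem_ge hS)
  -- As `l ≤ W`, rounding `W / l` down loses at most a factor 2; a sample thus hits with probability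
  -- at least `k / (2 * l)`.
  have hdiv : W ≤ 2 * (l * (W / l)) := by
    have h1 := Nat.div_add_mod W l
    have h2 := Nat.mod_lt W (by omega : 0 < l)
    have h3 : l * 1 ≤ l * (W / l) :=
      Nat.mul_le_mul_left _ ((Nat.one_le_div_iff (by omega)).2 hlW)
    omega
  have hfrac : (k : ℝ) / (2 * l) * W ≤ #H := by
    have h1 : (W : ℝ) ≤ 2 * (l * (W / l : ℕ)) := by exact_mod_cast hdiv
    have h2 : (k : ℝ) * (W / l : ℕ) ≤ #H := by exact_mod_cast hHge
    calc (k : ℝ) / (2 * l) * W ≤ k / (2 * l) * (2 * (l * (W / l : ℕ))) := by gcongr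
      _ = k * (W / l : ℕ) := by field_simp
      _ ≤ _ := h2
  have hexp : ((W - #H : ℕ) : ℝ) ≤ Real.exp (-(k / (2 * l))) * W := by
    rw [Nat.cast_sub hHW]
    have := Real.add_one_le_exp (-((k : ℝ) / (2 * l)))
    have := mul_le_mul_of_nonneg_right this hWr.le
    linarith
  -- At least `16 * e * l / k` samples with hit rate `k / (2 * l)` give `8 * e` expected hits.
  have hmr : 8 * (e : ℝ) ≤ m * (k / (2 * l)) := by
    have h1 : l ≤ k * (l / k + 1) := by
      have := Nat.div_add_mod l k
      have := Nat.mod_lt l hk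
      rw [Nat.mul_add]
      omega
    have h2 : (l : ℝ) ≤ k * ((l / k : ℕ) + 1) := by exact_mod_cast h1
    have h3 : (m : ℝ) = ((l / k : ℕ) + 1) * (16 * e) := by
      rw [hmdef, numSamples]; push_cast; ring
    rw [h3]
    rw [← mul_div_assoc, le_div_iff₀ (by positivity)]
    nlinarith [mul_le_mul_of_nonneg_left h2 (Nat.cast_nonneg (α := ℝ) e)]
  have hpow : Real.exp (-(k / (2 * l))) ^ m ≤ ((1 : ℝ) / 2 ^ e) ^ 8 := by
    rw [← Real.exp_nat_mul]
    have h2 : Real.exp (-1) ≤ 1 / 2 := by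
      rw [Real.exp_neg, one_div]
      refine inv_anti₀ (by norm_num) ?_
      have := Real.add_one_le_exp (1 : ℝ)
      linarith
    calc Real.exp (m * -(k / (2 * l))) ≤ Real.exp ((8 * e : ℕ) * (-1)) := by
          apply Real.exp_le_exp.2
          push_cast
          linarith
      _ = Real.exp (-1) ^ (8 * e) := Real.exp_nat_mul _ _
      _ ≤ (1 / 2) ^ (8 * e) := pow_le_pow_left₀ (Real.exp_pos _).le h2 _
      _ = (1 / 2 ^ e) ^ 8 := by rw [← one_div_pow, ← pow_mul, mul_comm]
  push_cast
  calc ((W - #H : ℕ) : ℝ) ^ m * (W : ℝ) ^ (T - m)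
      ≤ (Real.exp (-(k / (2 * l))) * W) ^ m * (W : ℝ) ^ (T - m) := by gcongr
    _ = Real.exp (-(k / (2 * l))) ^ m * ((W : ℝ) ^ m * (W : ℝ) ^ (T - m)) := by ring
    _ = Real.exp (-(k / (2 * l))) ^ m * (W : ℝ) ^ T := by
        rw [← pow_add, Nat.add_sub_of_le hm]
    _ ≤ _ := by gcongr

variable {n σ : ℕ}

theorem mismatches_subset (A B : Fin n → Fin σ) (k p z l : ℕ) :
    mismatches A B k p z l ⊆ range l := filter_subset _ _

open Classical in
/-- Few tapes are not good. -/
theorem card_not_good_le {T w k r e M : ℕ} (A B : Fin n → Fin σ) (hk : 0 < k)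
    (hn : 2 ≤ n) (hne : n ≤ 2 ^ e) (hr : r ≤ n) (hkr : 2 * k + r ≤ n)
    (hnW : n ≤ 2 ^ w) (hM : M = numSamples k (16 * e) n) (hMT : M ≤ T) :
    (#{ω : Fin T → Fin (2 ^ w) | ¬ Good A B k r (16 * e) (tapePrefix (env w A B ω).tape M)} : ℝ) ≤
      1 / n * ((2 ^ w : ℕ) : ℝ) ^ T := by
  -- The same words serve all windows, so the bad events are dependent; a union bound suffices.
  -- There are at most `n ^ 5` of them, each of probability at most `n ^ (-8)`.
  set I : Finset (ℕ × ℕ × ℕ × ℕ) := range (n + 1) ×ˢ Ioc 0 n ×ˢ range r ×ˢ range (2 * k + r)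
    with hI
  set bad : ℕ × ℕ × ℕ × ℕ → Finset (Fin T → Fin (2 ^ w)) := fun p =>
    if k < #(mismatches A B k (p.1 + p.2.2.1) (p.1 + p.2.2.2) p.2.1) then
      univ.filter fun ω => ∀ j : Fin T, (j : ℕ) < numSamples k (16 * e) p.2.1 →
        (ω j : ℕ) % p.2.1 ∉ mismatches A B k (p.1 + p.2.2.1) (p.1 + p.2.2.2) p.2.1
    else ∅ with hbad
  have hsub : (univ.filter fun ω : Fin T → Fin (2 ^ w) =>
      ¬ Good A B k r (16 * e) (tapePrefix (env w A B ω).tape M)) ⊆ I.biUnion bad := by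
    intro ω hω
    have hω := (mem_filter.1 hω).2
    unfold Good at hω
    push Not at hω
    obtain ⟨i, hi, l, hl, hln, b, hb, z, hz, hcard, hall⟩ := hω
    refine mem_biUnion.2 ⟨(i, l, b, z), ?_, ?_⟩
    · simp [hI]; omega
    · simp only [hbad]
      rw [if_pos hcard]
      simp only [mem_filter, mem_univ, true_and]
      intro j hj
      have h1 : numSamples k (16 * e) l ≤ M := hM ▸ numSamples_mono _ _ hln
      have h2 := hall j hj
      rw [tapePrefix, if_pos (by omega)] at h2
      simpa [env] using h2
  have hone : ∀ p ∈ I, (#(bad p) : ℝ) ≤ (1 / 2 ^ e) ^ 8 * ((2 ^ w : ℕ) : ℝ) ^ T := by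
    rintro ⟨i, l, b, z⟩ hp
    simp only [hI, mem_product, mem_range, mem_Ioc] at hp
    simp only [hbad]
    split_ifs with h
    · exact card_miss_le hk (mismatches_subset ..) h (by omega)
        ((numSamples_mono _ _ (by omega)).trans (hM ▸ hMT))
    · rw [card_empty, Nat.cast_zero]; positivity
  have hcI : (#I : ℝ) ≤ (n : ℝ) ^ 5 := by
    have : #I ≤ n ^ 5 := by
      simp only [hI, card_product, card_range, Nat.card_Ioc]
      calc (n + 1) * ((n - 0) * (r * (2 * k + r))) ≤ (n * n) * (n * (n * n)) := by
            gcongr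
            · nlinarith
            · omega
        _ = n ^ 5 := by ring
    exact_mod_cast this
  have hnr : (0 : ℝ) < n := by exact_mod_cast (by omega : 0 < n)
  have hn1 : (1 : ℝ) ≤ n := by exact_mod_cast (by omega : 1 ≤ n)
  have hpow : ((1 : ℝ) / 2 ^ e) ^ 8 ≤ (1 / n) ^ 8 := by
    have : (n : ℝ) ≤ 2 ^ e := by exact_mod_cast hne
    gcongr
  calc (#{ω : Fin T → Fin (2 ^ w) |
        ¬ Good A B k r (16 * e) (tapePrefix (env w A B ω).tape M)} : ℝ)
      ≤ (∑ p ∈ I, #(bad p) : ℕ) := by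
        exact_mod_cast (card_le_card hsub).trans card_biUnion_le
    _ = ∑ p ∈ I, (#(bad p) : ℝ) := by push_cast; rfl
    _ ≤ #I • ((1 / 2 ^ e) ^ 8 * ((2 ^ w : ℕ) : ℝ) ^ T) := sum_le_card_nsmul _ _ _ hone
    _ = #I * (1 / 2 ^ e) ^ 8 * ((2 ^ w : ℕ) : ℝ) ^ T := by rw [nsmul_eq_mul, mul_assoc]
    _ ≤ (n : ℝ) ^ 5 * (1 / n) ^ 8 * ((2 ^ w : ℕ) : ℝ) ^ T := by gcongr
    _ ≤ 1 / n * ((2 ^ w : ℕ) : ℝ) ^ T := by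
        gcongr
        rw [one_div_pow, mul_one_div, div_le_div_iff₀ (by positivity) hnr]
        calc (n : ℝ) ^ 5 * n = (n : ℝ) ^ 6 := by ring
          _ ≤ (n : ℝ) ^ 8 := pow_le_pow_right₀ hn1 (by norm_num)
          _ = 1 * (n : ℝ) ^ 8 := by ring

open Classical in
theorem answerProb_ge {P : Prog} {w k T r : ℕ} {A B : Fin n → Fin σ}
    (p : (Fin T → Fin (2 ^ w)) → Prop)
    (h : ∀ ω, p ω → Answers P w k A B r ω)
    {δ : ℝ} (hp : (#{ω | ¬ p ω} : ℝ) ≤ δ * ((2 ^ w : ℕ) : ℝ) ^ T) :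
    1 - δ ≤ answerProb P w k T A B r := by
  have hW : (0 : ℝ) < ((2 ^ w : ℕ) : ℝ) ^ T := by positivity
  unfold answerProb
  rw [Nat.card_eq_fintype_card, Nat.card_eq_fintype_card, Fintype.card_subtype, Fintype.card_fun,
    Fintype.card_fin, Fintype.card_fin, Nat.cast_pow, le_div_iff₀ hW]
  have hcount : (2 ^ w) ^ T ≤ #{ω : Fin T → Fin (2 ^ w) | Answers P w k A B r ω} +
      #{ω | ¬ p ω} := by
    have : (univ : Finset (Fin T → Fin (2 ^ w))) ⊆
        ({ω | Answers P w k A B r ω} : Finset (Fin T → Fin (2 ^ w))) ∪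
          ({ω | ¬ p ω} : Finset (Fin T → Fin (2 ^ w))) := by
      intro ω _
      by_cases hω : p ω
      · exact mem_union_left _ (by simpa using h ω hω)
      · exact mem_union_right _ (by simpa using hω)
    have := (card_le_card this).trans (card_union_le _ _)
    rwa [card_univ, Fintype.card_fun, Fintype.card_fin, Fintype.card_fin] at this
  have hcount' : ((2 ^ w : ℕ) : ℝ) ^ T ≤
      #{ω : Fin T → Fin (2 ^ w) | Answers P w k A B r ω} + #{ω | ¬ p ω} := by
    exact_mod_cast hcount
  linarith

theorem answerProb_eq_one {P : Prog} {w k T r : ℕ} {A B : Fin n → Fin σ}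
    (h : ∀ ω : Fin T → Fin (2 ^ w), Answers P w k A B r ω) :
    answerProb P w k T A B r = 1 := by
  unfold answerProb
  rw [Nat.card_congr (Equiv.subtypeUnivEquiv h), div_self]
  rw [Nat.card_eq_fintype_card, Fintype.card_fun, Fintype.card_fin, Fintype.card_fin]
  positivity

/-! ### Parameters -/

theorem ED_le (A B : Fin n → Fin σ) : ED A B ≤ n := by
  have h1 := sufDist_le_add_mismatches A B 0 0 0 n
  have h2 : #(mismatches A B 0 0 0 n) ≤ n := by
    simpa using card_le_card (mismatches_subset A B 0 0 0 n)
  have h3 : sufDist A B 0 (0 + n) (0 + n) = 0 := by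
    unfold sufDist
    rw [drop_ofFn_eq_nil A (by omega), drop_ofFn_eq_nil B (by omega), editDist_nil_left]
    rfl
  have h4 : ED A B = sufDist A B 0 0 0 := by simp [ED, sufDist]
  omega

/-- The factors are bounded by `4 * log (n + 1)` (twice), `2 * √k` and `9 * n / k`, and `32000 * 16
* 18 = 9216000`. The last bound uses `40 k ^ 2 < n` to absorb `k + 1`. -/
theorem timeBound_le {n k : ℕ} (hk : 1 ≤ k) (hkn : 40 * k ^ 2 < n) :
    (timeBound n k : ℝ) ≤ 9216000 * ((n : ℝ) / √(k : ℝ)) * Real.log ((n : ℝ) + 1) ^ 2 := by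
  have hn : 1 ≤ n := by omega
  have hkr : (1 : ℝ) ≤ k := by exact_mod_cast hk
  have hnr : (1 : ℝ) ≤ n := by exact_mod_cast hn
  have hs1 : (1 : ℝ) ≤ √(k : ℝ) := Real.one_le_sqrt.2 hkr
  have hss : √(k : ℝ) * √(k : ℝ) = k := Real.mul_self_sqrt (by linarith)
  have hsq : ((Nat.sqrt k : ℕ) : ℝ) + 1 ≤ 2 * √(k : ℝ) := by
    have : ((Nat.sqrt k : ℕ) : ℝ) ≤ √(k : ℝ) := Real.nat_sqrt_le_real_sqrt
    linarith
  have hlog : ((Nat.log 2 n : ℕ) : ℝ) + 1 ≤ 4 * Real.log (n + 1) := by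
    have h1 : 2 ^ (Nat.log 2 n + 1) ≤ (n + 1) ^ 2 := by
      have := Nat.pow_log_le_self 2 (by omega : n ≠ 0)
      rw [pow_succ]
      nlinarith
    have h2 : (2 : ℝ) ^ (Nat.log 2 n + 1) ≤ ((n : ℝ) + 1) ^ 2 := by exact_mod_cast h1
    have h3 := Real.log_le_log (by positivity) h2
    rw [Real.log_pow, Real.log_pow] at h3
    push_cast at h3
    have h4 : (1 : ℝ) / 2 ≤ Real.log 2 := by
      have := Real.log_two_gt_d9
      linarith
    have h5 : (0 : ℝ) ≤ (Nat.log 2 n : ℕ) + 1 := by positivity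
    nlinarith
  have hq : ((2 * (2 * n + 2) / k : ℕ) : ℝ) + (k + 1) ≤ 9 * (n / k) := by
    have h1 : ((2 * (2 * n + 2) / k : ℕ) : ℝ) ≤ (2 * (2 * n + 2) : ℕ) / (k : ℝ) :=
      Nat.cast_div_le
    have h2 : 40 * (k : ℝ) ^ 2 ≤ n := by exact_mod_cast hkn.le
    have h3 : ((2 * (2 * n + 2) : ℕ) : ℝ) / k ≤ 8 * (n / k) := by
      rw [← mul_div_assoc]
      gcongr
      push_cast
      linarith
    have h4 : (k : ℝ) + 1 ≤ n / k := by
      rw [le_div_iff₀ (by linarith)]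
      nlinarith
    linarith
  have hnk : 2 * √(k : ℝ) * (9 * (n / k)) = 18 * (n / √(k : ℝ)) := by
    rw [show (n : ℝ) / k = n / (√(k : ℝ) * √(k : ℝ)) by rw [hss]]
    generalize √(k : ℝ) = s at hs1
    have : s ≠ 0 := by linarith
    field_simp
    norm_num
  set s := √(k : ℝ)
  set g := Real.log ((n : ℝ) + 1)
  unfold timeBound
  push_cast
  calc (2000 * (((Nat.log 2 n : ℕ) + 1) * ((Nat.sqrt k : ℕ) + 1) *
        (16 * ((Nat.log 2 n : ℕ) + 1))) * (((2 * (2 * n + 2) / k : ℕ) : ℝ) + (k + 1)) : ℝ)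
      = 32000 * ((Nat.log 2 n : ℕ) + 1) ^ 2 *
        (((Nat.sqrt k : ℕ) + 1) * (((2 * (2 * n + 2) / k : ℕ) : ℝ) + (k + 1))) := by ring
    _ ≤ 32000 * (4 * g) ^ 2 * ((2 * s) * (9 * (n / k))) := by gcongr
    _ = 9216000 * (n / s) * g ^ 2 := by rw [hnk]; ring

/-- Even the constant time of the trivial branch must fit the bound: `√k ≤ k ≤ K √n ≤ |K| n` keeps
`n / √k` away from zero. Only here does the constant `C` depend on `K`. -/
theorem ten_le_bound {n k : ℕ} {K : ℝ} (hn : 1 ≤ n) (hk : 1 ≤ k) (hkK : (k : ℝ) ≤ K * √(n : ℝ)) :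
    (10 : ℝ) ≤ 40 * |K| * ((n : ℝ) / √(k : ℝ)) * Real.log ((n : ℝ) + 1) ^ 2 := by
  have hkr : (1 : ℝ) ≤ k := by exact_mod_cast hk
  have hnr : (1 : ℝ) ≤ n := by exact_mod_cast hn
  have hs1 : (1 : ℝ) ≤ √(k : ℝ) := Real.one_le_sqrt.2 hkr
  have hsk : √(k : ℝ) ≤ k := Real.sqrt_le_iff.2 ⟨by linarith, by nlinarith⟩
  have hsn : √(n : ℝ) ≤ n := Real.sqrt_le_iff.2 ⟨by linarith, by nlinarith⟩
  have h1 : 1 ≤ |K| * ((n : ℝ) / √(k : ℝ)) := by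
    rw [← mul_div_assoc, one_le_div (by linarith)]
    calc √(k : ℝ) ≤ K * √(n : ℝ) := hsk.trans hkK
      _ ≤ |K| * n := mul_le_mul (le_abs_self K) hsn (Real.sqrt_nonneg _) (abs_nonneg K)
  have h2 : (1 : ℝ) / 2 ≤ Real.log (n + 1) := by
    have h3 := Real.log_two_gt_d9
    have h4 : Real.log 2 ≤ Real.log (n + 1) := Real.log_le_log (by norm_num) (by linarith)
    linarith
  have h3 : (1 : ℝ) / 4 ≤ Real.log (n + 1) ^ 2 := by nlinarith
  calc (10 : ℝ) = 40 * 1 * (1 / 4) := by norm_num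
    _ ≤ 40 * (|K| * ((n : ℝ) / √(k : ℝ))) * Real.log ((n : ℝ) + 1) ^ 2 := by gcongr
    _ = _ := by ring

/-- The words are long enough for the numbers that the program handles. -/
theorem word_bounds {n k σ w c : ℕ} (hk : 0 < k) (hkn : 40 * k ^ 2 < n) (hc : 30 ≤ c)
    (hw : c * (Nat.log 2 n + Nat.log 2 σ + 1) ≤ w) :
    20 * n + 20 < 2 ^ w ∧ numSamples k (16 * (Nat.log 2 n + 1)) n + 1 < 2 ^ w ∧
    ((k + 1) * (2 * (Nat.log 2 n + 1) *
      ((Nat.sqrt k + 1) * numSamples k (16 * (Nat.log 2 n + 1)) n + 1)) + 2) * (σ + 1)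
        < 2 ^ w := by
  -- Every number handled is below a small power of `Y`; the tenth would do, so the exponent 30 is
  -- generous.
  set Y := 2 ^ (Nat.log 2 n + Nat.log 2 σ + 1) with hY
  have hYw : Y ^ 30 ≤ 2 ^ w := by
    rw [hY, ← pow_mul]
    refine Nat.pow_le_pow_right (by omega) (le_trans ?_ hw)
    rw [mul_comm]
    exact Nat.mul_le_mul_right _ hc
  have hYn : n + 1 ≤ Y :=
    (Nat.lt_pow_succ_log_self (by omega) n).trans_le (Nat.pow_le_pow_right (by omega) (by omega))
  have hYσ : σ + 1 ≤ Y :=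
    (Nat.lt_pow_succ_log_self (by omega) σ).trans_le (Nat.pow_le_pow_right (by omega) (by omega))
  have hkk : k ≤ k ^ 2 := Nat.le_self_pow (by omega) k
  have hsq := Nat.sqrt_le_self k
  have hlog : Nat.log 2 n < n := Nat.log_lt_self 2 (by omega)
  have hY40 : 41 ≤ Y := by omega
  have hns : numSamples k (16 * (Nat.log 2 n + 1)) n ≤ Y ^ 3 := by
    unfold numSamples
    have h1 : n / k + 1 ≤ Y := (Nat.add_le_add_right (Nat.div_le_self n k) 1).trans hYn
    calc (n / k + 1) * (16 * (Nat.log 2 n + 1)) ≤ Y * (Y * Y) := by gcongr <;> omega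
      _ = Y ^ 3 := by ring
  have hpow : ∀ a b, a < b → Y ^ a < Y ^ b := fun a b h => Nat.pow_lt_pow_right (by omega) h
  have h3 : Y ^ 3 + 1 ≤ Y ^ 4 := hpow 3 4 (by omega)
  refine ⟨?_, ?_, ?_⟩
  · calc 20 * n + 20 = 20 * (n + 1) := by ring
      _ ≤ Y * Y := by gcongr; omega
      _ = Y ^ 2 := by ring
      _ < Y ^ 30 := hpow _ _ (by omega)
      _ ≤ 2 ^ w := hYw
  · exact lt_of_lt_of_le (lt_of_le_of_lt (by omega) (hpow 4 30 (by omega))) hYw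
  · have h5 : (Nat.sqrt k + 1) * numSamples k (16 * (Nat.log 2 n + 1)) n + 1 ≤ Y ^ 5 := by
      have : (Nat.sqrt k + 1) * numSamples k (16 * (Nat.log 2 n + 1)) n ≤ Y * Y ^ 3 := by
        gcongr
        omega
      have h4 : Y ^ 4 + 1 ≤ Y ^ 5 := hpow 4 5 (by omega)
      have h6 : Y * Y ^ 3 = Y ^ 4 := by ring
      omega
    have h8 : (k + 1) * (2 * (Nat.log 2 n + 1) *
        ((Nat.sqrt k + 1) * numSamples k (16 * (Nat.log 2 n + 1)) n + 1)) ≤ Y ^ 8 := by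
      calc _ ≤ Y * (Y * Y * Y ^ 5) := by gcongr <;> omega
        _ = Y ^ 8 := by ring
    have h9 : Y ^ 8 + 2 ≤ Y ^ 9 := by
      have : Y ^ 9 = Y * Y ^ 8 := by ring
      have := Nat.pow_pos (n := 8) (by omega : 0 < Y)
      nlinarith
    calc _ ≤ Y ^ 9 * Y := by gcongr; omega
      _ = Y ^ 10 := by ring
      _ < Y ^ 30 := hpow _ _ (by omega)
      _ ≤ 2 ^ w := hYw

/-- In this branch `k ^ 2` may exceed `n`, but it is at most `K ^ 2 * n`; the `κ` additional bits
absorb the factor `40 * K ^ 2 + 40`. -/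
theorem word_bounds_of_le {n k σ w κ c : ℕ} {K : ℝ} (hn : 1 ≤ n)
    (hkK : (k : ℝ) ≤ K * √(n : ℝ)) (hκ : 40 * K ^ 2 + 40 < (2 : ℝ) ^ κ) (hc : κ + 1 ≤ c)
    (hw : c * (Nat.log 2 n + Nat.log 2 σ + 1) ≤ w) :
    40 * k ^ 2 + 40 < 2 ^ w ∧ n < 2 ^ w ∧ σ < 2 ^ w := by
  set a := Nat.log 2 n + Nat.log 2 σ + 1 with ha
  have h1 : κ * 1 + a ≤ w := by
    have h2 : (κ + 1) * a ≤ c * a := Nat.mul_le_mul_right _ hc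
    have h3 : κ * 1 ≤ κ * a := Nat.mul_le_mul_left _ (by omega)
    rw [Nat.add_mul] at h2
    omega
  have hYn : n < 2 ^ a :=
    (Nat.lt_pow_succ_log_self (by omega) n).trans_le (Nat.pow_le_pow_right (by omega) (by omega))
  have hYσ : σ < 2 ^ a :=
    (Nat.lt_pow_succ_log_self (by omega) σ).trans_le (Nat.pow_le_pow_right (by omega) (by omega))
  have haw : 2 ^ a ≤ 2 ^ w := Nat.pow_le_pow_right (by omega) (by omega)
  refine ⟨?_, hYn.trans_le haw, hYσ.trans_le haw⟩
  have hnr : (1 : ℝ) ≤ n := by exact_mod_cast hn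
  have hk2 : (k : ℝ) ^ 2 ≤ K ^ 2 * n := by
    calc (k : ℝ) ^ 2 ≤ (K * √(n : ℝ)) ^ 2 := pow_le_pow_left₀ (by positivity) hkK 2
      _ = K ^ 2 * n := by rw [mul_pow, Real.sq_sqrt (by positivity)]
  have h2 : (40 * (k : ℝ) ^ 2 + 40) < (2 : ℝ) ^ w := by
    calc (40 * (k : ℝ) ^ 2 + 40 : ℝ) ≤ (40 * K ^ 2 + 40) * n := by nlinarith
      _ < (2 : ℝ) ^ κ * n := by gcongr
      _ ≤ (2 : ℝ) ^ κ * (2 : ℝ) ^ a := by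
        gcongr
        exact_mod_cast hYn.le
      _ = (2 : ℝ) ^ (κ * 1 + a) := by rw [mul_one, ← pow_add]
      _ ≤ (2 : ℝ) ^ w := pow_le_pow_right₀ (by norm_num) h1
  exact_mod_cast h2

/-- The algorithm in the case `n ≤ 40 k ^ 2`. -/
theorem answers_small_of_le {k w T : ℕ} (hT : 10 ≤ T) (hk : 0 < k) (hkn : n ≤ 40 * k ^ 2)
    (hsz : 40 * k ^ 2 + 40 < 2 ^ w ∧ n < 2 ^ w ∧ σ < 2 ^ w) (A B : Fin n → Fin σ)
    (ω : Fin T → Fin (2 ^ w)) : Answers gapProg w k A B SMALL ω := by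
  obtain ⟨t, s, hex, ht, hs⟩ :=
    wp_gapProg_of_le (E := env w A B ω) hsz.1 hsz.2.1 hsz.2.2 hk hkn
  exact ⟨t, ht.trans hT, s, hex, hs⟩

/-- The algorithm in the case `40 k ^ 2 < n`. -/
theorem answers_of_lt {k w : ℕ} (hk : 0 < k) (hkn : 40 * k ^ 2 < n)
    (hw : 30 * (Nat.log 2 n + Nat.log 2 σ + 1) ≤ w) (A B : Fin n → Fin σ)
    (ω : Fin (timeBound n k) → Fin (2 ^ w)) :
    ∃ g i, Rounds A B k (Nat.sqrt k + 1) (16 * (Nat.log 2 n + 1))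
        (tapePrefix (env w A B ω).tape (numSamples k (16 * (Nat.log 2 n + 1)) n)) g i ∧
      g ≤ k + 1 ∧ (n < i ∧ Answers gapProg w k A B SMALL ω ∨
        i ≤ n ∧ g = k + 1 ∧ Answers gapProg w k A B LARGE ω) := by
  obtain ⟨h1, h2, h3⟩ := word_bounds hk hkn le_rfl hw
  obtain ⟨t, s, hex, ht, g, i, hrd, hg, hor⟩ :=
    wp_gapProg (E := env w A B ω) (A := A) (B := B) rfl rfl hk hkn h1 h2 h3
  refine ⟨g, i, hrd, hg, hor.imp (fun h => ⟨h.1, t, ht, s, hex, h.2⟩)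
    fun h => ⟨h.1, h.2.1, t, ht, s, hex, h.2.2⟩⟩

end GapED

/-! ### Assembly of the theorem -/

open GapED in
theorem mainTheorem1 :
    ∃ (P : WordRAM.Prog) (e : ℕ), ∀ K : ℝ, ∃ (C : ℝ) (c : ℕ),
      ∀ n k σ w : ℕ, 1 ≤ n → 1 ≤ k → (k : ℝ) ≤ K * √(n : ℝ) →
        c * (Nat.log 2 n + Nat.log 2 σ + 1) ≤ w →
        ∃ T : ℕ, (T : ℝ) ≤ C * ((n : ℝ) / √(k : ℝ)) * Real.log ((n : ℝ) + 1) ^ e ∧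
          ∀ A B : Fin n → Fin σ,
            (∀ ω : Fin T → Fin (2 ^ w),
              WordRAM.Answers P w k A B WordRAM.SMALL ω ∨
                WordRAM.Answers P w k A B WordRAM.LARGE ω) ∧
            (ED A B ≤ k →
              1 - 1 / (n : ℝ) ≤ WordRAM.answerProb P w k T A B WordRAM.SMALL) ∧
            (40 * k ^ 2 < ED A B →
              1 - 1 / (n : ℝ) ≤ WordRAM.answerProb P w k T A B WordRAM.LARGE) := by
  refine ⟨gapProg, 2, fun K => ?_⟩
  obtain ⟨κ, hκ⟩ := pow_unbounded_of_one_lt (40 * K ^ 2 + 40) (one_lt_two : (1 : ℝ) < 2)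
  refine ⟨9216000 + 40 * |K|, 30 + κ, fun n k σ w hn hk hkK hw => ?_⟩
  have hfac : 0 ≤ (n : ℝ) / √(k : ℝ) * Real.log ((n : ℝ) + 1) ^ 2 := by positivity
  have hinv : 0 ≤ 1 / (n : ℝ) := by positivity
  rcases Nat.lt_or_ge (40 * k ^ 2) n with hkn | hkn
  · refine ⟨timeBound n k, ?_, fun A B => ?_⟩
    · have := timeBound_le hk hkn
      nlinarith [mul_nonneg (abs_nonneg K) hfac]
    have hw' : 30 * (Nat.log 2 n + Nat.log 2 σ + 1) ≤ w :=
      (Nat.mul_le_mul_right _ (by omega)).trans hw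
    have hans := answers_of_lt (σ := σ) hk hkn hw' A B
    have hkk : k ≤ k ^ 2 := Nat.le_self_pow (by omega) k
    have hsq := Nat.sqrt_le_self k
    refine ⟨fun ω => ?_, fun hED => ?_, fun hED => ?_⟩
    · obtain ⟨g, i, -, -, h | h⟩ := hans ω
      · exact .inl h.2
      · exact .inr h.2.2
    · rw [answerProb_eq_one fun ω => ?_]
      · linarith
      obtain ⟨g, i, hrd, hg, h | ⟨hi, hgk, -⟩⟩ := hans ω
      · exact h.2
      -- Stopping inside the string would need `k + 1` rounds, while at most `k` are possible; this
      -- holds for every tape, so the probability is one.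
      · have := card_rounds_le (Nat.succ_pos _) hED le_rfl hrd hi
        omega
    · have hnW : n ≤ 2 ^ w := by
        have := (word_bounds hk hkn le_rfl hw').1
        omega
      -- The tape must hold all samples; the time bound gives this when the other phases are taken
      -- to last zero steps.
      have hMT : numSamples k (16 * (Nat.log 2 n + 1)) n ≤ timeBound n k := by
        have := time_le_timeBound (n := n) (t₁ := 0) (t₂ := 0) (t₄ := 0) hk (Nat.zero_le _)
          (Nat.zero_le _) le_rfl (Nat.zero_le _)
        omega
      refine answerProb_ge (fun ω => Good A B k (Nat.sqrt k + 1) (16 * (Nat.log 2 n + 1))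
          (tapePrefix (WordRAM.env w A B ω).tape (numSamples k (16 * (Nat.log 2 n + 1)) n)))
        (fun ω hgood => ?_) ?_
      · obtain ⟨g, i, hrd, hg, ⟨hi, -⟩ | h⟩ := hans ω
        · have h1 := ED_le_of_rounds hgood hrd hi
          -- From `k ≥ 1`: `k + 1 ≤ 2 * k`, and `⌊√k⌋ ≤ k` gives `3 * k + 3 * (⌊√k⌋ + 1) + 2 ≤ 11 *
          -- k`.
          have h2 : g * (3 * k + 3 * (Nat.sqrt k + 1) + 2) ≤ (2 * k) * (11 * k) :=
            Nat.mul_le_mul (by omega) (by omega)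
          have h3 : (2 * k) * (11 * k) = 22 * k ^ 2 := by ring
          omega
        · exact h.2.2
      · exact card_not_good_le A B hk (by omega)
          (Nat.lt_pow_succ_log_self (by omega) n).le (by omega) (by omega) hnW rfl hMT
  · refine ⟨10, ?_, fun A B => ?_⟩
    · have := ten_le_bound hn hk hkK
      push_cast
      nlinarith
    have hans := answers_small_of_le (T := 10) le_rfl hk hkn
      (word_bounds_of_le hn hkK hκ (by omega) hw) A B
    refine ⟨fun ω => .inl (hans ω), fun _ => ?_, fun hED => ?_⟩
    · rw [answerProb_eq_one hans]
      linarith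
    · have := ED_le A B
      omega
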